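/- For integers $0\le r$ and $0\le t$ let $S_{r,1,t}:=\sum_{1\le i_1<\dots<i_r\le t}\frac{1}{i_1\cdots i_r}$ (so $S_{0,1,t}=1$, and $S_{r,1,t}=0$ for $t<r$). Let $B_k$ be the Bernoulli numbers with $B_1=-\tfrac12$, $\gamma$ Euler's constant, $\zeta$ the Riemann zeta function and $\zeta^{(p)}$ its $p$-th derivative. Let $p\ge 1$ be an integer, and put $$c_{p,r}:=\frac{(-1)^r p!}{(p-r)!}\,\zeta(r+1),\qquad d_{p,r,k}:=\frac{(-1)^r p!}{(p-r)!}\,S_{r-1,1,k-1}\qquad(1\le r\le p,\ k\ge 1).$$ Then for every integer $m\ge 0$, as $n\to\infty$ through the positive integers, $$\sum_{k=1}^{n-1}\frac{(\log k)^p}{n-k}=(\log n)^{p+1}+\gamma(\log n)^p+\sum_{r=1}^{p}c_{p,r}(\log n)^{p-r}-\sum_{k=1}^{m}\Big(\frac{(-1)^kB_k}{k^2}\sum_{r=1}^{p}d_{p,r,k}(\log n)^{p-r}-(-1)^p\zeta^{(p)}(1-k)\Big)\frac1{n^k}+O\Big(\frac{(\log n)^{p-1}}{n^{m+1}}\Big),$$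 where the implied constant may depend on $p$ and $m$. Hence the constant term of the expansion is $(-1)^p p!\,\zeta(p+1)$, that is, $$\lim_{n\to\infty}\Big(\sum_{k=1}^{n-1}\frac{(\log k)^p}{n-k}-(\log n)^{p+1}-\gamma(\log n)^p-\sum_{r=1}^{p-1}c_{p,r}(\log n)^{p-r}\Big)=(-1)^p\,p!\,\zeta(p+1).$$ -/

import Mathlib

open Filter Topology Asymptotics

namespace LogSum

/-- `S r s t = ∑ 1 / (i₁ ⋯ i_r)`, the sum over all integers `s ≤ i₁ < ⋯ < i_r ≤ t`
(so `S 0 s t = 1`, the empty product). The increasing `r`-tuples are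
the `r`-element subsets of `{s, …, t}`. -/
def S (r s t : ℕ) : ℚ :=
  ∑ A ∈ (Finset.Icc s t).powersetCard r, ∏ i ∈ A, (1 / (i : ℚ))

/-- `c_{p,r} = (-1)^r p! / (p-r)! · ζ(r+1)`, used for `1 ≤ r ≤ p`. -/
noncomputable def c (p r : ℕ) : ℂ :=
  (-1) ^ r * (p.factorial : ℂ) / ((p - r).factorial : ℂ) * riemannZeta ((r : ℂ) + 1)

/-- `d_{p,r,k} = (-1)^r p! / (p-r)! · S_{r-1,1,k-1}`, used for `1 ≤ r ≤ p` and `1 ≤ k`. -/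
def d (p r k : ℕ) : ℚ :=
  (-1) ^ r * (p.factorial : ℚ) / ((p - r).factorial : ℚ) * S (r - 1) 1 (k - 1)

/-- The sum `∑_{k=1}^{n-1} (log k)^p / (n-k)`. -/
noncomputable def logSum (p n : ℕ) : ℝ :=
  ∑ k ∈ Finset.Ico 1 n, Real.log k ^ p / ((n : ℝ) - (k : ℝ))

/-- The coefficient of `1 / n^k` (`1 ≤ k`) in the expansion; it depends on `n` through `log n`:
`-( (-1)^k B_k / k² · ∑_{r=1}^p d_{p,r,k} (log n)^{p-r} - (-1)^p ζ^{(p)}(1-k) )`.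
Here `bernoulli` has `B_1 = -1/2`. -/
noncomputable def coeff (p k n : ℕ) : ℂ :=
  -((-1) ^ k * (bernoulli k : ℂ) / (k : ℂ) ^ 2 *
      ∑ r ∈ Finset.Icc 1 p, (d p r k : ℂ) * (Real.log n : ℂ) ^ (p - r)
    - (-1) ^ p * iteratedDeriv p riemannZeta (1 - (k : ℂ)))

end LogSum

namespace LogSum

/-! The logarithms are generated by a complex exponent: the `p`-th derivative at `z = 0` of `convSum
z n = ∑ k^z/(n-k)` is the sum in question. It suffices to expand `convSum z n` with an error uniform
on `‖z‖ ≤ 1/2` and a main part holomorphic in `z`; Cauchy's estimate then lets the expansion be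
differentiated term by term (`norm_logSum_sub_iteratedDeriv_le`).

For the expansion, `1/(n-k)` is replaced by a finite geometric sum plus a tail
(`convSum_eq_sum_add`). The geometric part consists of power sums `∑ k^(z+j)`, whose Euler–Maclaurin
constant is `ζ(-z-j)` by analytic continuation (`tendsto_zetaApprox`). The tail is a sum with
exponent `a = z + M` of large real part; it equals `n^a` times a harmonic number minus a Riemann sum
of `(1-x^a)/(1-x)`, now smooth enough for Euler–Maclaurin (`norm_convSum_sub_le_of_re`).

On recombining, the dependence on `M` cancels: the boundary terms telescope to falling factorials of
`z` alone (`sum_ff`), and the constants assemble into `-ψ(1+z)` (`digammaSeries_eq`).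
Differentiating at `0`, `log n · n^z` gives the leading power, the Taylor coefficients of `-ψ(1+z)`
give `γ` and the `c p r`, those of the falling factorials give the `d p r k`, and `ζ(-j-z)` gives
the derivatives of zeta. -/

/-! ### Euler–Maclaurin on a unit interval. -/

theorem integral_bernoulliFun_mul {f f' : ℝ → ℂ} {a : ℝ} (N : ℕ)
    (hf : ∀ y ∈ Set.Icc a (a + 1), HasDerivAt f (f' y) y)
    (hc : ContinuousOn f' (Set.Icc a (a + 1))) :
    ∫ y in a..a + 1, (bernoulliFun N (y - a) : ℂ) * f y =
      (bernoulliFun (N + 1) 1 : ℂ) / (N + 1) * f (a + 1)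
        - (bernoulliFun (N + 1) 0 : ℂ) / (N + 1) * f a
        - (1 / (N + 1)) * ∫ y in a..a + 1, (bernoulliFun (N + 1) (y - a) : ℂ) * f' y := by
  have hab : a ≤ a + 1 := by linarith
  have h := intervalIntegral.integral_deriv_mul_eq_sub_of_hasDeriv_right (a := a) (b := a + 1)
    (u := fun y => (bernoulliFun (N + 1) (y - a) : ℂ) / (N + 1)) (v := f)
    (u' := fun y => (bernoulliFun N (y - a) : ℂ)) (v' := f') ?_ ?_ ?_ ?_ ?_ ?_
  · rw [intervalIntegral.integral_add] at h
    · have e : ∀ y, (bernoulliFun (N + 1) (y - a) : ℂ) / (N + 1) * f' y =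
        (1 / (N + 1)) * ((bernoulliFun (N + 1) (y - a) : ℂ) * f' y) := fun y => by ring
      simp_rw [e] at h
      rw [intervalIntegral.integral_const_mul] at h
      simp only [add_sub_cancel_left, sub_self] at h
      rw [← h]; ring
    · apply ContinuousOn.intervalIntegrable
      rw [Set.uIcc_of_le hab]
      refine ContinuousOn.mul (Continuous.continuousOn (by fun_prop)) ?_
      exact fun y hy => (hf y hy).continuousAt.continuousWithinAt
    · apply ContinuousOn.intervalIntegrable
      rw [Set.uIcc_of_le hab]
      exact ContinuousOn.mul (Continuous.continuousOn (by fun_prop)) hc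
  · exact Continuous.continuousOn (by fun_prop)
  · rw [Set.uIcc_of_le hab]
    exact fun y hy => (hf y hy).continuousAt.continuousWithinAt
  · intro y _
    have h1 := (antideriv_bernoulliFun N (y - a)).ofReal_comp
    have h2 := h1.comp_sub_const y a
    simpa using h2.hasDerivWithinAt
  · intro y hy
    rw [min_eq_left hab, max_eq_right hab] at hy
    exact (hf y ⟨hy.1.le, hy.2.le⟩).hasDerivWithinAt
  · exact Continuous.intervalIntegrable (by fun_prop) _ _
  · apply ContinuousOn.intervalIntegrable
    rwa [Set.uIcc_of_le hab]

/-- Odd-index Bernoulli numbers other than `B_1` vanish, so the alternating signs in Euler–Maclaurin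
can be dropped. -/
theorem neg_one_pow_mul_bernoulli {k : ℕ} (hk : k ≠ 1) : (-1) ^ k * bernoulli k = bernoulli k := by
  rw [bernoulli_eq_bernoulli'_of_ne_one hk]
  conv_rhs => rw [← bernoulli_eq_bernoulli'_of_ne_one hk, bernoulli]

/-- The Euler–Maclaurin formula on a unit interval. -/
theorem euler_maclaurin_unit (f : ℕ → ℝ → ℂ) (a : ℝ) (N : ℕ)
    (hf : ∀ i ≤ N, ∀ y ∈ Set.Icc a (a + 1), HasDerivAt (f i) (f (i + 1) y) y)
    (hc : ContinuousOn (f (N + 1)) (Set.Icc a (a + 1))) :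
    f 0 a = (∫ y in a..a + 1, f 0 y)
      + ∑ i ∈ Finset.range (N + 1), (bernoulli (i + 1) : ℂ) / ((i + 1).factorial : ℂ)
          * (f i (a + 1) - f i a)
      + (-1) ^ N / ((N + 1).factorial : ℂ)
          * ∫ y in a..a + 1, (bernoulliFun (N + 1) (y - a) : ℂ) * f (N + 1) y := by
  induction N with
  | zero =>
    have h := integral_bernoulliFun_mul 0 (hf 0 le_rfl) hc
    simp only [bernoulliFun_zero, bernoulliFun_eval_one, bernoulliFun_eval_zero, zero_add,
      bernoulli_one, if_true, Finset.sum_range_one] at h ⊢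
    push_cast at h ⊢
    simp only [one_mul, zero_add, div_one, Nat.factorial_one, pow_zero, Nat.cast_one] at h ⊢
    rw [h]; ring
  | succ N ih =>
    have hc' : ContinuousOn (f (N + 1)) (Set.Icc a (a + 1)) :=
      fun y hy => (hf (N + 1) le_rfl y hy).continuousAt.continuousWithinAt
    -- Integrate the remainder by parts once more. Since `N + 2 ≠ 1`, the Bernoulli polynomial has
    -- equal values at both ends, so the boundary term is a plain difference of `f (N + 1)`.
    rw [ih (fun i hi => hf i (by omega)) hc',
      integral_bernoulliFun_mul (N + 1) (hf (N + 1) le_rfl) hc, Finset.sum_range_succ _ (N + 1),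
      bernoulliFun_endpoints_eq_of_ne_one (by omega), bernoulliFun_eval_zero]
    have h1 : ((N + 1 : ℕ).factorial : ℂ) ≠ 0 := by exact_mod_cast (N + 1).factorial_ne_zero
    have h2 : ((N : ℂ) + 1 + 1) ≠ 0 := by exact_mod_cast (by omega : N + 1 + 1 ≠ 0)
    rw [Nat.factorial_succ (N + 1)]
    push_cast
    have h3 := neg_one_pow_mul_bernoulli (k := N + 2) (by omega)
    rw [pow_add, neg_one_sq, mul_one] at h3
    have h4 : (bernoulli (N + 1 + 1) : ℂ) = (-1) ^ N * (bernoulli (N + 1 + 1) : ℂ) := by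
      exact_mod_cast h3.symm
    generalize ∑ i ∈ Finset.range (N + 1), (bernoulli (i + 1) : ℂ) / ((i + 1).factorial : ℂ)
      * (f i (a + 1) - f i a) = A
    field_simp
    linear_combination -(f (N + 1) (a + 1) - f (N + 1) a) * h4

/-- The constant is the maximum of the Bernoulli polynomial on `[0, 1]`. That it is independent of
`f` is what makes every later estimate uniform in the complex exponent. -/
theorem euler_maclaurin_unit_bound (N : ℕ) : ∃ K : ℝ, 0 ≤ K ∧
    ∀ (f : ℕ → ℝ → ℂ) (a C : ℝ),
      (∀ i ≤ N, ∀ y ∈ Set.Icc a (a + 1), HasDerivAt (f i) (f (i + 1) y) y) →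
      ContinuousOn (f (N + 1)) (Set.Icc a (a + 1)) →
      (∀ y ∈ Set.Icc a (a + 1), ‖f (N + 1) y‖ ≤ C) →
      ‖f 0 a - ((∫ y in a..a + 1, f 0 y)
        + ∑ i ∈ Finset.range (N + 1), (bernoulli (i + 1) : ℂ) / ((i + 1).factorial : ℂ)
          * (f i (a + 1) - f i a))‖ ≤ K * C := by
  obtain ⟨B, hB⟩ := isCompact_Icc.exists_bound_of_continuousOn
    (continuous_bernoulliFun (N + 1)).continuousOn (s := Set.Icc (0 : ℝ) 1)
  have hB0 : 0 ≤ B := (norm_nonneg _).trans (hB 0 (by simp))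
  refine ⟨B, hB0, fun f a C hf hc hC => ?_⟩
  rw [euler_maclaurin_unit f a N hf hc, add_sub_cancel_left, norm_mul]
  have h1 : ‖∫ y in a..a + 1, (bernoulliFun (N + 1) (y - a) : ℂ) * f (N + 1) y‖ ≤ B * C := by
    refine (intervalIntegral.norm_integral_le_of_norm_le_const (C := B * C) ?_).trans (by simp)
    intro y hy
    rw [Set.uIoc_of_le (by linarith)] at hy
    rw [norm_mul, Complex.norm_real]
    exact mul_le_mul (hB _ ⟨by linarith [hy.1], by linarith [hy.2]⟩) (hC y ⟨hy.1.le, hy.2⟩)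
      (norm_nonneg _) hB0
  have h2 : ‖(-1 : ℂ) ^ N / ((N + 1).factorial : ℂ)‖ ≤ 1 := by
    rw [norm_div, norm_pow, norm_neg, norm_one, one_pow, Complex.norm_natCast]
    exact div_le_one_of_le₀ (by exact_mod_cast (N + 1).factorial_pos) (by positivity)
  calc _ ≤ 1 * (B * C) := mul_le_mul h2 h1 (norm_nonneg _) zero_le_one
    _ = B * C := one_mul _

/-! ### Falling factorials and derivatives of powers. -/

/-- The falling factorial `z (z - 1) ⋯ (z - i + 1)`. -/
def ff (z : ℂ) (i : ℕ) : ℂ := ∏ j ∈ Finset.range i, (z - j)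

theorem ff_zero (z : ℂ) : ff z 0 = 1 := by simp [ff]

theorem ff_succ (z : ℂ) (i : ℕ) : ff z (i + 1) = ff z i * (z - i) := Finset.prod_range_succ _ _

theorem ff_succ' (z : ℂ) (i : ℕ) : ff z (i + 1) = z * ff (z - 1) i := by
  rw [ff, Finset.prod_range_succ', ff, mul_comm]
  simp only [Nat.cast_zero, sub_zero, Nat.cast_add, Nat.cast_one]
  congr 1
  exact Finset.prod_congr rfl fun j _ => by ring

theorem ff_add_one_sub (z : ℂ) (i : ℕ) :
    ff (z + 1) (i + 1) - ff z (i + 1) = (i + 1) * ff z i := by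
  rw [ff_succ', ff_succ, add_sub_cancel_right]; ring

theorem norm_ff_le {z : ℂ} {R : ℝ} (hz : ‖z‖ ≤ R) (i : ℕ) : ‖ff z i‖ ≤ (R + i) ^ i := by
  have hR : 0 ≤ R := (norm_nonneg z).trans hz
  rw [ff, norm_prod]
  calc _ ≤ ∏ _j ∈ Finset.range i, (R + i) := by
        refine Finset.prod_le_prod (fun _ _ => norm_nonneg _) fun j hj => ?_
        have hj' : (j : ℝ) ≤ i := by exact_mod_cast (Finset.mem_range.1 hj).le
        refine (norm_sub_le _ _).trans ?_
        rw [Complex.norm_natCast]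
        linarith
    _ = _ := by simp

theorem differentiable_ff (i : ℕ) : Differentiable ℂ fun z => ff z i := by
  unfold ff; fun_prop

/-- The affine base serves both `y^z` and the segment powers `(1 - t + (t/n) y)^(a-1)`; each
derivative brings out one factor `c`. -/
theorem hasDerivAt_affine_cpow (z : ℂ) (b c : ℝ) (i : ℕ) {y : ℝ} (hy : 0 < b + c * y) :
    HasDerivAt (fun y : ℝ => ff z i * (c : ℂ) ^ i * ((b + c * y : ℝ) : ℂ) ^ (z - i))
      (ff z (i + 1) * (c : ℂ) ^ (i + 1) * ((b + c * y : ℝ) : ℂ) ^ (z - (i + 1 : ℕ))) y := by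
  have h1 : HasDerivAt (fun w : ℂ => (b : ℂ) + c * w) (c : ℂ) y := by
    simpa using ((hasDerivAt_id (y : ℂ)).const_mul (c : ℂ)).const_add (b : ℂ)
  have hs : (b : ℂ) + c * y ∈ Complex.slitPlane := by
    exact_mod_cast Complex.ofReal_mem_slitPlane.2 hy
  have h2 := ((h1.cpow_const (c := z - i) hs).const_mul (ff z i * (c : ℂ) ^ i)).comp_ofReal
  push_cast
  convert! h2 using 1
  rw [ff_succ, pow_succ, show z - ((i : ℂ) + 1) = z - i - 1 by ring]
  ring

/-! ### Power sums: increments and convergence. -/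

/-- `∑_{k=1}^{n-1} k^z`. -/
noncomputable def powSum (z : ℂ) (n : ℕ) : ℂ := ∑ k ∈ Finset.Ico 1 n, (k : ℂ) ^ z

/-- The boundary terms of the Euler–Maclaurin formula for `x ↦ x^z` at `n`. -/
noncomputable def emCorr (z : ℂ) (N n : ℕ) : ℂ :=
  ∑ i ∈ Finset.range N,
    (bernoulli (i + 1) : ℂ) / ((i + 1).factorial : ℂ) * (ff z i * (n : ℂ) ^ (z - i))

theorem powSum_succ (z : ℂ) {n : ℕ} (hn : 1 ≤ n) : powSum z (n + 1) = powSum z n + (n : ℂ) ^ z :=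
  Finset.sum_Ico_succ_top hn _

/-- The increment is exactly the Euler–Maclaurin remainder on `[n, n+1]`. The antiderivative `A`
stays free so as to cover both `y^(z+1)/(z+1)` and, at `z = -1`, the logarithm. The condition `z.re
≤ N + 1` makes the bound on the last derivative largest at the left end. -/
theorem norm_powSum_step (N : ℕ) : ∃ K : ℝ, 0 ≤ K ∧ ∀ (z : ℂ) (R : ℝ) (A : ℝ → ℂ) (n : ℕ),
    1 ≤ n → ‖z‖ ≤ R → z.re ≤ N + 1 → (∀ y : ℝ, 0 < y → HasDerivAt A ((y : ℂ) ^ z) y) →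
    ‖(powSum z (n + 1) - A (n + 1 : ℕ) - emCorr z (N + 1) (n + 1)) -
      (powSum z n - A n - emCorr z (N + 1) n)‖ ≤
      K * (R + (N + 1 : ℕ)) ^ (N + 1) * (n : ℝ) ^ (z.re - (N + 1)) := by
  obtain ⟨K, hK, h⟩ := euler_maclaurin_unit_bound N
  refine ⟨K, hK, fun z R A n hn hz hre hA => ?_⟩
  have hn0 : (0 : ℝ) < n := by exact_mod_cast hn
  have hR : 0 ≤ R := (norm_nonneg z).trans hz
  have hpos : ∀ y ∈ Set.Icc (n : ℝ) (n + 1), 0 < y := fun y hy => hn0.trans_le hy.1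
  have hd : ∀ i, ∀ y ∈ Set.Icc (n : ℝ) (n + 1),
      HasDerivAt (fun y : ℝ => ff z i * (y : ℂ) ^ (z - i))
        (ff z (i + 1) * (y : ℂ) ^ (z - (i + 1 : ℕ))) y := by
    intro i y hy
    have := hasDerivAt_affine_cpow z 0 1 i (y := y) (by simpa using hpos y hy)
    simpa using this
  have hcont : ∀ i, ContinuousOn (fun y : ℝ => ff z i * (y : ℂ) ^ (z - i))
      (Set.Icc (n : ℝ) (n + 1)) := fun i y hy => (hd i y hy).continuousAt.continuousWithinAt
  have key := h (fun i y => ff z i * (y : ℂ) ^ (z - i)) n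
    ((R + (N + 1 : ℕ)) ^ (N + 1) * (n : ℝ) ^ (z.re - (N + 1))) (fun i _ => hd i)
    (hcont (N + 1)) ?_
  · have hint : ∫ y in (n : ℝ)..n + 1, ff z 0 * (y : ℂ) ^ (z - (0 : ℕ)) = A (n + 1) - A n := by
      refine intervalIntegral.integral_eq_sub_of_hasDerivAt (fun y hy => ?_) ?_
      · rw [Set.uIcc_of_le (by linarith)] at hy
        simpa [ff_zero] using hA y (hpos y hy)
      · apply ContinuousOn.intervalIntegrable
        rw [Set.uIcc_of_le (by linarith)]
        exact hcont 0
    rw [hint] at key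
    rw [powSum_succ z hn, mul_assoc]
    refine le_of_eq_of_le ?_ key
    congr 1
    simp only [mul_sub, Finset.sum_sub_distrib, emCorr, ff_zero]
    push_cast
    simp only [sub_zero, one_mul]
    ring
  · intro y hy
    rw [norm_mul, Complex.norm_cpow_eq_rpow_re_of_pos (hpos y hy)]
    refine mul_le_mul (norm_ff_le hz _) ?_ (Real.rpow_nonneg (hpos y hy).le _) (by positivity)
    simp only [Complex.sub_re, Complex.natCast_re]
    push_cast
    exact Real.rpow_le_rpow_of_nonpos hn0 hy.1 (by linarith)

/-- Write `m^e = m^(e+2) / m^2`: the first factor is at most `n^(e+2)` because `e ≤ -2`, and `1/m^2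
≤ 2 (1/m - 1/(m+1))` telescopes. -/
theorem norm_sub_le_of_step {u : ℕ → ℂ} {C e : ℝ} (hC : 0 ≤ C) (he : e ≤ -2)
    (h : ∀ n : ℕ, 1 ≤ n → ‖u (n + 1) - u n‖ ≤ C * (n : ℝ) ^ e) {n m : ℕ} (hn : 1 ≤ n)
    (hm : n ≤ m) : ‖u m - u n‖ ≤ 2 * C * (n : ℝ) ^ (e + 1) := by
  have hn0 : (0 : ℝ) < n := by exact_mod_cast hn
  have key : ‖u m - u n‖ ≤ 2 * C * (n : ℝ) ^ (e + 2) * (1 / n - 1 / m) := by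
    induction m, hm using Nat.le_induction with
    | base => simp
    | succ m hm ih =>
      have hnm : (n : ℝ) ≤ m := by exact_mod_cast hm
      have hm0 : (0 : ℝ) < m := hn0.trans_le hnm
      have h1 : (m : ℝ) ^ e ≤ (n : ℝ) ^ (e + 2) * (2 * (1 / m - 1 / (m + 1))) := by
        have : (m : ℝ) ^ e = (m : ℝ) ^ (e + 2) * (1 / m ^ 2) := by
          rw [Real.rpow_add hm0, Real.rpow_two]; field_simp
        rw [this]
        refine mul_le_mul (Real.rpow_le_rpow_of_nonpos hn0 hnm (by linarith)) ?_ (by positivity)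
          (by positivity)
        have hm1 : (1 : ℝ) ≤ m := by exact_mod_cast hn.trans hm
        rw [div_sub_div _ _ hm0.ne' (by positivity), mul_div_assoc', div_le_div_iff₀ (by positivity)
          (by positivity)]
        nlinarith
      calc ‖u (m + 1) - u n‖ ≤ ‖u (m + 1) - u m‖ + ‖u m - u n‖ := norm_sub_le_norm_sub_add_norm_sub ..
        _ ≤ C * ((n : ℝ) ^ (e + 2) * (2 * (1 / m - 1 / (m + 1)))) +
            2 * C * (n : ℝ) ^ (e + 2) * (1 / n - 1 / m) :=
          add_le_add ((h m (hn.trans hm)).trans (mul_le_mul_of_nonneg_left h1 hC)) ih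
        _ = _ := by push_cast; ring
  refine key.trans ?_
  rw [show e + 2 = (e + 1) + 1 by ring, Real.rpow_add_one hn0.ne']
  have : (1 : ℝ) / n - 1 / m ≤ 1 / n := by
    have : (0 : ℝ) ≤ 1 / m := by positivity
    linarith
  calc _ ≤ 2 * C * ((n : ℝ) ^ (e + 1) * n) * (1 / n) := by gcongr
    _ = _ := by field_simp

theorem norm_sub_limit_le_of_step {u : ℕ → ℂ} {C e : ℝ} {l : ℂ} (hC : 0 ≤ C) (he : e ≤ -2)
    (h : ∀ n : ℕ, 1 ≤ n → ‖u (n + 1) - u n‖ ≤ C * (n : ℝ) ^ e) (hl : Tendsto u atTop (𝓝 l))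
    {n : ℕ} (hn : 1 ≤ n) : ‖u n - l‖ ≤ 2 * C * (n : ℝ) ^ (e + 1) := by
  have h1 : Tendsto (fun m => ‖u m - u n‖) atTop (𝓝 ‖l - u n‖) := (hl.sub_const _).norm
  rw [norm_sub_rev]
  refine le_of_tendsto h1 ?_
  filter_upwards [eventually_ge_atTop n] with m hm
  exact norm_sub_le_of_step hC he h hn hm

theorem exists_limit_of_step {u : ℕ → ℂ} {C e : ℝ} (hC : 0 ≤ C) (he : e ≤ -2)
    (h : ∀ n : ℕ, 1 ≤ n → ‖u (n + 1) - u n‖ ≤ C * (n : ℝ) ^ e) :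
    ∃ l, Tendsto u atTop (𝓝 l) := by
  refine cauchySeq_tendsto_of_complete (cauchySeq_of_le_tendsto_0'
    -- The increments are controlled only from `n = 1` on, so the Cauchy bound at index `0` is
    -- supplied separately.
    (fun n : ℕ => if n = 0 then ‖u 0 - u 1‖ + 2 * C else 2 * C * (n : ℝ) ^ (e + 1)) ?_ ?_)
  · intro n m hm
    rw [dist_comm, dist_eq_norm]
    rcases Nat.eq_zero_or_pos n with rfl | hn
    · rw [if_pos rfl]
      rcases Nat.eq_zero_or_pos m with rfl | hm'
      · simp only [sub_self, norm_zero]; positivity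
      · have := norm_sub_le_of_step hC he h le_rfl hm'
        simp only [Nat.cast_one, Real.one_rpow, mul_one] at this
        calc _ ≤ ‖u m - u 1‖ + ‖u 1 - u 0‖ := norm_sub_le_norm_sub_add_norm_sub ..
          _ ≤ _ := by rw [norm_sub_rev (u 1)]; linarith
    · rw [if_neg hn.ne']
      exact norm_sub_le_of_step hC he h hn hm
  · have h1 : Tendsto (fun n : ℕ => 2 * C * (n : ℝ) ^ (e + 1)) atTop (𝓝 0) := by
      have := ((tendsto_rpow_neg_atTop (y := -(e + 1)) (by linarith)).comp
        tendsto_natCast_atTop_atTop).const_mul (2 * C)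
      simpa [Function.comp_def] using this
    refine h1.congr' ?_
    filter_upwards [eventually_ge_atTop 1] with n hn
    rw [if_neg (by omega)]

/-! ### The Euler–Maclaurin constant is a zeta value. -/

/-- An entire version of `(z + 1) (powSum z n - n^(z+1)/(z+1) - emCorr z N n)`. -/
noncomputable def zetaApprox (N n : ℕ) (z : ℂ) : ℂ :=
  (z + 1) * (powSum z n - emCorr z N n) - (n : ℂ) ^ (z + 1)

theorem hasDerivAt_ofReal_cpow_antideriv {z : ℂ} (hz : z ≠ -1) {y : ℝ} (hy : 0 < y) :
    HasDerivAt (fun y : ℝ => (y : ℂ) ^ (z + 1) / (z + 1)) ((y : ℂ) ^ z) y :=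
  hasDerivAt_ofReal_cpow_const' hy.ne' hz

theorem zetaApprox_eq {N n : ℕ} {z : ℂ} (hz : z ≠ -1) :
    zetaApprox N n z =
      (z + 1) * (powSum z n - (n : ℂ) ^ (z + 1) / (z + 1) - emCorr z N n) := by
  have : z + 1 ≠ 0 := fun h => hz (eq_neg_of_add_eq_zero_left h)
  rw [zetaApprox]
  field_simp
  ring

theorem differentiable_zetaApprox (N : ℕ) {n : ℕ} (hn : 1 ≤ n) :
    Differentiable ℂ (zetaApprox N n) := by
  have hc : ∀ k : ℕ, 1 ≤ k → ∀ c : ℂ, Differentiable ℂ fun z : ℂ => (k : ℂ) ^ (z + c) := by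
    intro k hk c
    have : (k : ℂ) ≠ 0 := by exact_mod_cast (by omega : k ≠ 0)
    exact (differentiable_id.add_const c).const_cpow (Or.inl this)
  unfold zetaApprox powSum emCorr
  refine (((differentiable_id.add_const 1).mul (Differentiable.sub ?_ ?_))).sub (hc n hn 1)
  · refine Differentiable.fun_sum fun k hk => ?_
    simpa using hc k (Finset.mem_Ico.1 hk).1 0
  · refine Differentiable.fun_sum fun i _ => ?_
    refine Differentiable.const_mul ((differentiable_ff i).mul ?_) _
    simpa [sub_eq_add_neg] using hc n hn (-i)

theorem norm_zetaApprox_step (N : ℕ) : ∃ K : ℝ, 0 ≤ K ∧ ∀ (z : ℂ) (R : ℝ) (n : ℕ),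
    1 ≤ n → ‖z‖ ≤ R → z.re ≤ N + 1 →
    ‖zetaApprox (N + 1) (n + 1) z - zetaApprox (N + 1) n z‖ ≤
      (R + 1) * (K * (R + (N + 1 : ℕ)) ^ (N + 1)) * (n : ℝ) ^ (z.re - (N + 1)) := by
  obtain ⟨K, hK, h⟩ := norm_powSum_step N
  refine ⟨K, hK, fun z R n hn hz hre => ?_⟩
  have hR : 0 ≤ R := (norm_nonneg z).trans hz
  by_cases hz1 : z = -1
  · subst hz1
    have : ∀ m : ℕ, zetaApprox (N + 1) m (-1) = -1 := fun m => by simp [zetaApprox]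
    rw [this, this, sub_self, norm_zero]
    positivity
  · rw [zetaApprox_eq hz1, zetaApprox_eq hz1, ← mul_sub, norm_mul, mul_assoc]
    refine mul_le_mul ?_ ?_ (norm_nonneg _) (by positivity)
    · refine (norm_add_le _ _).trans ?_
      simpa using hz
    · simpa using h z R (fun y : ℝ => (y : ℂ) ^ (z + 1) / (z + 1)) n hn hz hre
        (fun y hy => hasDerivAt_ofReal_cpow_antideriv hz1 hy)

theorem tendsto_natCast_cpow_zero {z : ℂ} (hz : z.re < 0) :
    Tendsto (fun n : ℕ => (n : ℂ) ^ z) atTop (𝓝 0) := by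
  rw [tendsto_zero_iff_norm_tendsto_zero]
  have := (tendsto_rpow_neg_atTop (y := -z.re) (by linarith)).comp tendsto_natCast_atTop_atTop
  simp only [neg_neg] at this
  refine this.congr' ?_
  filter_upwards [eventually_ge_atTop 1] with n hn
  simp [Complex.norm_natCast_cpow_of_pos hn]

theorem tendsto_powSum {z : ℂ} (hz : z.re < -1) :
    Tendsto (powSum z) atTop (𝓝 (riemannZeta (-z))) := by
  have hs : 1 < (-z).re := by simpa using by linarith
  have hsum : Summable fun k : ℕ => 1 / ((k : ℂ) + 1) ^ (-z) := by
    have := (summable_nat_add_iff 1).2 (Complex.summable_one_div_nat_cpow.2 hs)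
    simpa using this
  rw [zeta_eq_tsum_one_div_nat_add_one_cpow hs, ← tendsto_add_atTop_iff_nat 1]
  refine hsum.hasSum.tendsto_sum_nat.congr fun n => ?_
  rw [powSum, Finset.sum_Ico_eq_sum_range, Nat.add_sub_cancel]
  refine Finset.sum_congr rfl fun k _ => ?_
  rw [Complex.cpow_neg, one_div, inv_inv, add_comm]
  push_cast
  rfl

theorem tendsto_zetaApprox_of_re_lt (N : ℕ) {z : ℂ} (hz : z.re < -1) :
    Tendsto (fun n => zetaApprox N n z) atTop (𝓝 (-riemannZeta₁ (-z))) := by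
  have h1 : Tendsto (fun n => emCorr z N n) atTop (𝓝 0) := by
    have : Tendsto (fun n => emCorr z N n) atTop (𝓝 (∑ i ∈ Finset.range N,
        (bernoulli (i + 1) : ℂ) / ((i + 1).factorial : ℂ) * (ff z i * 0))) := by
      refine tendsto_finsetSum _ fun i _ => ((tendsto_natCast_cpow_zero ?_).const_mul _).const_mul _
      simp only [Complex.sub_re, Complex.natCast_re]
      have : (0 : ℝ) ≤ i := by positivity
      linarith
    simpa using this
  have h2 := ((tendsto_powSum hz).sub h1).const_mul (z + 1) |>.sub
    (tendsto_natCast_cpow_zero (z := z + 1) (by simpa using by linarith))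
  have hne : -z ≠ 1 := by
    intro h
    have := congrArg Complex.re h
    simp at this
    linarith
  have hne' : -z - 1 ≠ 0 := sub_ne_zero.2 hne
  have e : (z + 1) * (riemannZeta (-z) - 0) - 0 = -riemannZeta₁ (-z) := by
    rw [riemannZeta_eq_inv_sub_mul hne]
    field_simp
    ring
  rwa [e] at h2

/-- Analytic continuation. On the half-plane the increments are `O(n^e)` with `e < -2`, locally
uniformly, so the limit is holomorphic there; near `-3` it is already known from the convergent
series, and the identity theorem does the rest. The factor `z + 1` cancels the pole at `z = -1`, so
the half-plane needs no puncture. -/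
theorem tendsto_zetaApprox (N : ℕ) {z : ℂ} (hz : z.re < N - 1) :
    Tendsto (fun n => zetaApprox (N + 1) n z) atTop (𝓝 (-riemannZeta₁ (-z))) := by
  obtain ⟨K, hK, hstep⟩ := norm_zetaApprox_step N
  set D : Set ℂ := {z | z.re < N - 1} with hD
  have hDo : IsOpen D := isOpen_lt Complex.continuous_re continuous_const
  have hDc : IsPreconnected D := (convex_halfSpace_re_lt _).isPreconnected
  have hC : ∀ R : ℝ, 0 ≤ R → 0 ≤ (R + 1) * (K * (R + (N + 1 : ℕ)) ^ (N + 1)) := fun R hR => by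
    positivity
  have hex : ∀ z : ℂ, ∃ l, z ∈ D → Tendsto (fun n => zetaApprox (N + 1) n z) atTop (𝓝 l) := by
    intro z
    by_cases hz : z ∈ D
    · have hz' : z.re < N - 1 := hz
      obtain ⟨l, hl⟩ := exists_limit_of_step (u := fun n => zetaApprox (N + 1) n z)
        (hC ‖z‖ (norm_nonneg _)) (by linarith) fun n hn =>
        hstep z ‖z‖ n hn le_rfl (by linarith)
      exact ⟨l, fun _ => hl⟩
    · exact ⟨0, fun h => absurd h hz⟩
  choose V hV using hex
  have hunif : TendstoLocallyUniformlyOn (fun n z => zetaApprox (N + 1) n z) V atTop D := by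
    rw [tendstoLocallyUniformlyOn_iff_forall_isCompact hDo]
    intro T hT hTc
    obtain ⟨R, hR⟩ := hTc.isBounded.exists_norm_le
    set R' := max R 0
    have hR' : ∀ z ∈ T, ‖z‖ ≤ R' := fun z hz => (hR z hz).trans (le_max_left _ _)
    set C := (R' + 1) * (K * (R' + (N + 1 : ℕ)) ^ (N + 1))
    have hC0 : 0 ≤ C := hC R' (le_max_right _ _)
    rw [Metric.tendstoUniformlyOn_iff]
    intro ε hε
    have hlim : Tendsto (fun n : ℕ => 2 * C * ((n : ℝ))⁻¹) atTop (𝓝 0) := by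
      simpa using (tendsto_inv_atTop_nhds_zero_nat (𝕜 := ℝ)).const_mul (2 * C)
    filter_upwards [eventually_ge_atTop 1, hlim.eventually (gt_mem_nhds hε)] with n hn hn' z hz
    have hzD : z.re < N - 1 := hT hz
    rw [dist_comm, dist_eq_norm]
    have h1 := norm_sub_limit_le_of_step (u := fun n => zetaApprox (N + 1) n z) hC0
      (by linarith) (fun n hn => hstep z R' n hn (hR' z hz) (by linarith)) (hV z (hT hz)) hn
    refine (h1.trans ?_).trans_lt hn'
    gcongr
    rw [← Real.rpow_neg_one]
    exact Real.rpow_le_rpow_of_exponent_le (by exact_mod_cast hn) (by linarith)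
  have hVd : DifferentiableOn ℂ V D := by
    refine hunif.differentiableOn ?_ hDo
    filter_upwards [eventually_ge_atTop 1] with n hn
    exact (differentiable_zetaApprox (N + 1) hn).differentiableOn
  have hζd : DifferentiableOn ℂ (fun z => -riemannZeta₁ (-z)) D :=
    Differentiable.differentiableOn (by fun_prop)
  have hEq : Set.EqOn V (fun z => -riemannZeta₁ (-z)) D := by
    have hN : (0 : ℝ) ≤ N := by positivity
    have h3 : (-3 : ℂ) ∈ D := by simpa [hD] using by linarith
    refine (hVd.analyticOnNhd hDo).eqOn_of_preconnected_of_eventuallyEq (hζd.analyticOnNhd hDo)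
      hDc h3 ?_
    have hnh : {z : ℂ | z.re < -1} ∈ 𝓝 (-3 : ℂ) :=
      (isOpen_lt Complex.continuous_re continuous_const).mem_nhds (by norm_num)
    filter_upwards [hnh, hDo.mem_nhds h3] with z hz hzD
    exact tendsto_nhds_unique (hV z hzD) (tendsto_zetaApprox_of_re_lt (N + 1) hz)
  have := hV z hz
  rwa [hEq hz] at this

theorem norm_emCorr_sub_le (R : ℝ) {N N' : ℕ} (hN : N ≤ N') : ∃ K : ℝ, 0 ≤ K ∧
    ∀ (z : ℂ) (n : ℕ), 1 ≤ n → ‖z‖ ≤ R →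
      ‖emCorr z N' n - emCorr z N n‖ ≤ K * (n : ℝ) ^ (z.re - N) := by
  refine ⟨∑ i ∈ Finset.Ico N N', ‖(bernoulli (i + 1) : ℂ) / ((i + 1).factorial : ℂ)‖ *
    (max R 0 + i) ^ i, Finset.sum_nonneg fun i _ => by positivity, fun z n hn hz => ?_⟩
  rw [emCorr, emCorr, ← Finset.sum_Ico_eq_sub _ hN, Finset.sum_mul]
  refine (norm_sum_le _ _).trans (Finset.sum_le_sum fun i hi => ?_)
  have hi' : (N : ℝ) ≤ i := by exact_mod_cast (Finset.mem_Ico.1 hi).1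
  rw [norm_mul, norm_mul, mul_assoc]
  refine mul_le_mul_of_nonneg_left (mul_le_mul (norm_ff_le (hz.trans (le_max_left _ _)) i) ?_
    (norm_nonneg _) (by positivity)) (norm_nonneg _)
  rw [Complex.norm_natCast_cpow_of_pos hn]
  refine Real.rpow_le_rpow_of_exponent_le (by exact_mod_cast hn) ?_
  simp only [Complex.sub_re, Complex.natCast_re]
  linarith

/-- The asymptotic expansion of `∑_{k<n} k^z`, uniformly for bounded `z`. -/
theorem norm_powSum_sub_le (R : ℝ) (N : ℕ) : ∃ K : ℝ, 0 ≤ K ∧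
    ∀ (z : ℂ) (n : ℕ), 1 ≤ n → ‖z‖ ≤ R → z ≠ -1 →
      ‖powSum z n - (riemannZeta (-z) + (n : ℂ) ^ (z + 1) / (z + 1) + emCorr z N n)‖ ≤
        K * (n : ℝ) ^ (z.re - N) := by
  -- Work at an order so high that every `‖z‖ ≤ R` satisfies `z.re < Q - 1`, where the limit is
  -- known; then discard the surplus boundary terms, each `O(n^(z.re - N))`.
  set Q := N + ⌈R⌉₊ + 2 with hQ
  obtain ⟨K₁, hK₁, h₁⟩ := norm_powSum_step Q
  obtain ⟨K₂, hK₂, h₂⟩ := norm_emCorr_sub_le R (N := N) (N' := Q + 1) (by omega)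
  refine ⟨2 * (K₁ * (max R 0 + (Q + 1 : ℕ)) ^ (Q + 1)) + K₂, by positivity,
    fun z n hn hz hz1 => ?_⟩
  have hzre : z.re ≤ R := (Complex.re_le_norm z).trans hz
  have hQR : R + N + 2 ≤ Q := by
    rw [hQ]; push_cast
    linarith [Nat.le_ceil R]
  have hN0 : (0 : ℝ) ≤ N := by positivity
  have hne : z + 1 ≠ 0 := fun h => hz1 (eq_neg_of_add_eq_zero_left h)
  have hlim : Tendsto (fun n : ℕ => powSum z n - (n : ℂ) ^ (z + 1) / (z + 1)
      - emCorr z (Q + 1) n) atTop (𝓝 (riemannZeta (-z))) := by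
    have := (tendsto_zetaApprox Q (z := z) (by linarith)).const_mul (z + 1)⁻¹
    simp_rw [zetaApprox_eq hz1, inv_mul_cancel_left₀ hne] at this
    convert this using 2
    have hne1 : -z ≠ 1 := fun h => hz1 (by rw [← h, neg_neg])
    have hne' : -z - 1 ≠ 0 := sub_ne_zero.2 hne1
    rw [riemannZeta_eq_inv_sub_mul hne1]
    field_simp
    ring
  have h3 := norm_sub_limit_le_of_step (e := z.re - (Q + 1)) (n := n)
    (C := K₁ * (max R 0 + (Q + 1 : ℕ)) ^ (Q + 1)) (by positivity) (by linarith)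
    (fun n hn => by
      simpa using h₁ z (max R 0) (fun y : ℝ => (y : ℂ) ^ (z + 1) / (z + 1)) n hn
        (hz.trans (le_max_left _ _)) (by linarith)
        (fun y hy => hasDerivAt_ofReal_cpow_antideriv hz1 hy)) hlim hn
  calc _ = ‖(powSum z n - (n : ℂ) ^ (z + 1) / (z + 1) - emCorr z (Q + 1) n - riemannZeta (-z))
        + (emCorr z (Q + 1) n - emCorr z N n)‖ := by congr 1; ring
    _ ≤ 2 * (K₁ * (max R 0 + (Q + 1 : ℕ)) ^ (Q + 1)) * (n : ℝ) ^ (z.re - (Q + 1) + 1)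
        + K₂ * (n : ℝ) ^ (z.re - N) := (norm_add_le _ _).trans (add_le_add h3 (h₂ z n hn hz))
    _ ≤ 2 * (K₁ * (max R 0 + (Q + 1 : ℕ)) ^ (Q + 1)) * (n : ℝ) ^ (z.re - N)
        + K₂ * (n : ℝ) ^ (z.re - N) := by
      gcongr
      · exact_mod_cast hn
      · have : 0 ≤ R := (norm_nonneg z).trans hz
        linarith
    _ = _ := by ring

/-- The asymptotic expansion of the harmonic numbers. -/
theorem norm_powSum_neg_one_sub_le (N : ℕ) : ∃ K : ℝ, 0 ≤ K ∧ ∀ n : ℕ, 1 ≤ n →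
    ‖powSum (-1) n - (Real.eulerMascheroniConstant + Real.log n + emCorr (-1) N n)‖ ≤
      K * (n : ℝ) ^ (-1 - N : ℝ) := by
  obtain ⟨K₁, hK₁, h₁⟩ := norm_powSum_step (N + 1)
  obtain ⟨K₂, hK₂, h₂⟩ := norm_emCorr_sub_le 1 (N := N) (N' := N + 1 + 1) (by omega)
  refine ⟨2 * (K₁ * (1 + (N + 1 + 1 : ℕ)) ^ (N + 1 + 1)) + K₂, by positivity, fun n hn => ?_⟩
  have hN0 : (0 : ℝ) ≤ N := by positivity
  have hlog : Tendsto (fun n : ℕ => powSum (-1) n - (Real.log n : ℂ)) atTop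
      (𝓝 (Real.eulerMascheroniConstant : ℂ)) := by
    -- `powSum (-1) n` stops at `n - 1`, hence the subtraction of `1/n` from the harmonic number.
    have h := Real.tendsto_harmonic_sub_log.sub (tendsto_inv_atTop_nhds_zero_nat (𝕜 := ℝ))
    rw [sub_zero] at h
    refine ((Complex.continuous_ofReal.tendsto _).comp h).congr' ?_
    filter_upwards [eventually_ge_atTop 1] with n hn
    have hp : powSum (-1) (n + 1) = (harmonic n : ℂ) := by
      rw [powSum, harmonic_eq_sum_Icc]
      push_cast
      exact Finset.sum_congr rfl fun k _ => Complex.cpow_neg_one _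
    rw [powSum_succ _ hn, Complex.cpow_neg_one] at hp
    simp only [Function.comp_apply]
    push_cast
    rw [← hp]; ring
  have hlim : Tendsto (fun n : ℕ => powSum (-1) n - (Real.log n : ℂ)
      - emCorr (-1) (N + 1 + 1) n) atTop (𝓝 (Real.eulerMascheroniConstant : ℂ)) := by
    have h1 : Tendsto (fun n => emCorr (-1) (N + 1 + 1) n) atTop (𝓝 0) := by
      have : Tendsto (fun n => emCorr (-1) (N + 1 + 1) n) atTop (𝓝 (∑ i ∈ Finset.range (N + 1 + 1),
          (bernoulli (i + 1) : ℂ) / ((i + 1).factorial : ℂ) * (ff (-1) i * 0))) := by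
        refine tendsto_finsetSum _ fun i _ =>
          ((tendsto_natCast_cpow_zero ?_).const_mul _).const_mul _
        simp only [Complex.sub_re, Complex.natCast_re, Complex.neg_re, Complex.one_re]
        have : (0 : ℝ) ≤ i := by positivity
        linarith
      simpa using this
    simpa using hlog.sub h1
  have hA : ∀ y : ℝ, 0 < y →
      HasDerivAt (fun y : ℝ => (Real.log y : ℂ)) ((y : ℂ) ^ (-1 : ℂ)) y := by
    intro y hy
    rw [Complex.cpow_neg_one, ← Complex.ofReal_inv]
    exact (Real.hasDerivAt_log hy.ne').ofReal_comp
  have h3 := norm_sub_limit_le_of_step (e := -1 - ((N + 1 : ℕ) + 1)) (n := n)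
    (C := K₁ * (1 + (N + 1 + 1 : ℕ)) ^ (N + 1 + 1)) (by positivity) (by push_cast; linarith)
    (fun n hn => by
      simpa using h₁ (-1) 1 (fun y : ℝ => (Real.log y : ℂ)) n hn (by simp)
        (by simp; linarith) hA) hlim hn
  have h4 := h₂ (-1) n hn (by simp)
  rw [Complex.neg_re, Complex.one_re] at h4
  calc _ = ‖(powSum (-1) n - (Real.log n : ℂ) - emCorr (-1) (N + 1 + 1) n
          - Real.eulerMascheroniConstant)
        + (emCorr (-1) (N + 1 + 1) n - emCorr (-1) N n)‖ := by congr 1; ring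
    _ ≤ _ := (norm_add_le _ _).trans (add_le_add h3 h4)
    _ ≤ 2 * (K₁ * (1 + (N + 1 + 1 : ℕ)) ^ (N + 1 + 1)) * (n : ℝ) ^ (-1 - N : ℝ)
        + K₂ * (n : ℝ) ^ (-1 - N : ℝ) := by
      gcongr
      · exact_mod_cast hn
      · push_cast; linarith
    _ = _ := by ring

/-! ### Riemann sums of `(1 - x^a)/(1 - x)`. -/

theorem euler_maclaurin_bound (N : ℕ) : ∃ K : ℝ, 0 ≤ K ∧
    ∀ (f : ℕ → ℝ → ℂ) (A : ℝ → ℂ) (n : ℕ) (C : ℝ),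
      (∀ y ∈ Set.Icc (0 : ℝ) n, HasDerivAt A (f 0 y) y) →
      (∀ i, ∀ y ∈ Set.Icc (0 : ℝ) n, HasDerivAt (f i) (f (i + 1) y) y) →
      (∀ y ∈ Set.Icc (0 : ℝ) n, ‖f (N + 1) y‖ ≤ C) →
      ‖∑ k ∈ Finset.range n, f 0 k - ((A n - A 0)
        + ∑ i ∈ Finset.range (N + 1), (bernoulli (i + 1) : ℂ) / ((i + 1).factorial : ℂ)
          * (f i n - f i 0))‖ ≤ n * (K * C) := by
  obtain ⟨K, hK, h⟩ := euler_maclaurin_unit_bound N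
  refine ⟨K, hK, fun f A n C hA hf hC => ?_⟩
  have hsub : ∀ k ∈ Finset.range n, Set.Icc (k : ℝ) (k + 1) ⊆ Set.Icc (0 : ℝ) n := by
    intro k hk
    have : (k : ℝ) + 1 ≤ n := by exact_mod_cast Finset.mem_range.1 hk
    exact Set.Icc_subset_Icc (by positivity) this
  set G : ℕ → ℂ := fun k => A k + ∑ i ∈ Finset.range (N + 1),
    (bernoulli (i + 1) : ℂ) / ((i + 1).factorial : ℂ) * f i k with hG
  have e : ∑ k ∈ Finset.range n, f 0 k - ((A n - A 0)
        + ∑ i ∈ Finset.range (N + 1), (bernoulli (i + 1) : ℂ) / ((i + 1).factorial : ℂ)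
          * (f i n - f i 0)) = ∑ k ∈ Finset.range n, (f 0 k - (G (k + 1) - G k)) := by
    rw [Finset.sum_sub_distrib, Finset.sum_range_sub]
    simp only [hG, mul_sub, Finset.sum_sub_distrib, Nat.cast_zero]
    ring
  rw [e]
  refine (norm_sum_le _ _).trans ?_
  refine (Finset.sum_le_card_nsmul _ _ (K * C) fun k hk => ?_).trans (by simp)
  have hcont : ∀ i, ContinuousOn (f i) (Set.Icc (k : ℝ) (k + 1)) := fun i y hy =>
    (hf i y (hsub k hk hy)).continuousAt.continuousWithinAt
  have hint : ∫ y in (k : ℝ)..k + 1, f 0 y = A (k + 1) - A k := by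
    refine intervalIntegral.integral_eq_sub_of_hasDerivAt (fun y hy => ?_) ?_
    · rw [Set.uIcc_of_le (by linarith)] at hy
      exact hA y (hsub k hk hy)
    · apply ContinuousOn.intervalIntegrable
      rw [Set.uIcc_of_le (by linarith)]
      exact hcont 0
  have key := h f k C (fun i _ y hy => hf i y (hsub k hk hy)) (hcont _)
    (fun y hy => hC y (hsub k hk hy))
  rw [hint] at key
  refine le_of_eq_of_le ?_ key
  simp only [hG, mul_sub, Finset.sum_sub_distrib]
  push_cast
  congr 1
  ring

/-- The harmonic number of complex index `a`, namely `∫₀¹ (1 - (1-t)^a)/t dt`. -/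
noncomputable def harm (a : ℂ) : ℂ := ∫ t : ℝ in 0..1, (1 - ((1 - t : ℝ) : ℂ) ^ a) / t

/-- A divided difference is the mean of the derivative along the segment from `1` to `x`. This
replaces a quotient with a removable singularity by a superposition of affine powers, whose
derivatives are explicit. -/
theorem integral_cpow_segment {a : ℂ} (ha : 1 < a.re) {x : ℝ} (hx1 : x < 1) (hx0 : 0 ≤ x) :
    ∫ t : ℝ in 0..1, a * ((1 - t * (1 - x) : ℝ) : ℂ) ^ (a - 1) =
      (1 - (x : ℂ) ^ a) / (1 - x) := by
  have hx : (1 - (x : ℂ)) ≠ 0 := by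
    have : (1 - x : ℝ) ≠ 0 := by linarith
    exact_mod_cast this
  have hc : Continuous fun t : ℝ => ((1 - t * (1 - x) : ℝ) : ℂ) ^ a :=
    (Complex.continuous_ofReal_cpow_const (y := a) (by linarith)).comp (by fun_prop)
  have hc' : Continuous fun t : ℝ => ((1 - t * (1 - x) : ℝ) : ℂ) ^ (a - 1) :=
    (Complex.continuous_ofReal_cpow_const (y := a - 1) (by simpa using ha)).comp (by fun_prop)
  rw [intervalIntegral.integral_eq_sub_of_hasDerivAt_of_le zero_le_one
    (f := fun t : ℝ => -((1 - t * (1 - x) : ℝ) : ℂ) ^ a / (1 - x))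
    (hc.neg.div_const _).continuousOn _ (Continuous.intervalIntegrable (by fun_prop) _ _)]
  · simp only [one_mul, zero_mul, sub_zero, sub_sub_cancel, Complex.ofReal_one, Complex.one_cpow]
    ring
  · intro t ht
    have hpos : 0 < 1 + (-(1 - x)) * t := by nlinarith [ht.1, ht.2]
    have := (hasDerivAt_affine_cpow a 1 (-(1 - x)) 0 hpos).neg.div_const (1 - (x : ℂ))
    simp only [ff_zero, pow_zero, one_mul, Nat.cast_zero, sub_zero, zero_add, pow_one,
      ff_succ, Nat.cast_one] at this
    have e : ∀ t : ℝ, 1 + -(1 - x) * t = 1 - t * (1 - x) := fun t => by ring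
    simp only [e] at this
    convert! this using 1
    push_cast
    field_simp

theorem norm_one_sub_cpow_div_le {a : ℂ} (ha : 1 < a.re) {x : ℝ} (hx1 : x < 1) (hx0 : 0 ≤ x) :
    ‖(1 - (x : ℂ) ^ a) / (1 - x)‖ ≤ ‖a‖ := by
  rw [← integral_cpow_segment ha hx1 hx0]
  refine (intervalIntegral.norm_integral_le_of_norm_le_const (C := ‖a‖) ?_).trans (by simp)
  intro t ht
  rw [Set.uIoc_of_le zero_le_one] at ht
  have h0 : 0 ≤ 1 - t * (1 - x) := by nlinarith [ht.1, ht.2]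
  have h1 : 1 - t * (1 - x) ≤ 1 := by nlinarith [ht.1, ht.2]
  rw [norm_mul]
  refine mul_le_of_le_one_right (norm_nonneg _) ?_
  rw [Complex.norm_cpow_eq_rpow_re_of_nonneg h0 (by simpa using by linarith)]
  exact Real.rpow_le_one h0 h1 (by simpa using ha.le)

theorem intervalIntegrable_harm {a : ℂ} (ha : 1 < a.re) :
    IntervalIntegrable (fun t : ℝ => (1 - ((1 - t : ℝ) : ℂ) ^ a) / t) MeasureTheory.volume 0 1 := by
  rw [intervalIntegrable_iff_integrableOn_Ioc_of_le zero_le_one]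
  refine MeasureTheory.Measure.integrableOn_of_bounded (M := ‖a‖) (by simp) ?_ ?_
  · have hc : Continuous fun t : ℝ => ((1 - t : ℝ) : ℂ) ^ a :=
      (Complex.continuous_ofReal_cpow_const (y := a) (by linarith)).comp (by fun_prop)
    exact ((continuous_const.sub hc).measurable.div
      Complex.continuous_ofReal.measurable).aestronglyMeasurable
  · refine (MeasureTheory.ae_restrict_iff' measurableSet_Ioc).2 (Eventually.of_forall fun t ht => ?_)
    have := norm_one_sub_cpow_div_le ha (x := 1 - t) (by linarith [ht.1]) (by linarith [ht.2])
    simpa using this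

theorem ff_mul_betaIntegral {a : ℂ} {i : ℕ} (ha : (i : ℝ) < a.re) :
    ff a (i + 1) * ∫ t : ℝ in 0..1, (t : ℂ) ^ i * ((1 - t : ℝ) : ℂ) ^ (a - 1 - i) =
      (i.factorial : ℂ) := by
  have h : ∫ t : ℝ in 0..1, (t : ℂ) ^ i * ((1 - t : ℝ) : ℂ) ^ (a - 1 - i) =
      Complex.betaIntegral (i + 1) (a - i) := by
    rw [Complex.betaIntegral]
    congr 1
    ext t
    push_cast
    rw [add_sub_cancel_right, Complex.cpow_natCast, sub_right_comm]
  have hre : 0 < (a - i).re := by simpa using ha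
  rw [h, ← Complex.betaIntegral_symm, Complex.betaIntegral_eval_nat_add_one_right hre]
  have e : ff a (i + 1) = ∏ j ∈ Finset.range (i + 1), (a - i + j) := by
    rw [ff, ← Finset.prod_range_reflect]
    refine Finset.prod_congr rfl fun j hj => ?_
    have := Finset.mem_range.1 hj
    rw [show i + 1 - 1 - j = i - j by omega, Nat.cast_sub (by omega)]
    ring
  rw [e, mul_div_cancel₀]
  refine Finset.prod_ne_zero_iff.2 fun j _ h0 => ?_
  have := congrArg Complex.re h0
  simp at this
  have hj : (0 : ℝ) ≤ j := by positivity
  linarith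

/-- The mean over `t` of one boundary term: a monomial minus the Beta integral `B(i+1, a-i)`. The
resulting `i!` later cancels against the harmonic number. -/
theorem integral_boundary {a : ℂ} {i : ℕ} (ha : (i : ℝ) + 1 < a.re) :
    ∫ t : ℝ in 0..1, ff a (i + 1) * ((t : ℂ) ^ i * (1 - ((1 - t : ℝ) : ℂ) ^ (a - 1 - i))) =
      ff a (i + 1) / (i + 1) - i.factorial := by
  have hc : Continuous fun t : ℝ => ((1 - t : ℝ) : ℂ) ^ (a - 1 - i) :=
    (Complex.continuous_ofReal_cpow_const (by simpa using by linarith)).comp (by fun_prop)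
  have h1 : ∫ t : ℝ in 0..1, (t : ℂ) ^ i = 1 / (i + 1) := by
    have : ∫ t : ℝ in 0..1, (t : ℂ) ^ i = ((∫ t : ℝ in 0..1, t ^ i : ℝ) : ℂ) := by
      rw [← intervalIntegral.integral_ofReal]
      congr 1; ext t; push_cast; rfl
    rw [this, integral_pow]
    simp
  rw [intervalIntegral.integral_const_mul]
  simp_rw [mul_sub, mul_one]
  rw [intervalIntegral.integral_sub (Continuous.intervalIntegrable (by fun_prop) _ _)
    (Continuous.intervalIntegrable (by fun_prop) _ _), h1, mul_sub,
    ff_mul_betaIntegral (by linarith)]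
  ring

/-- Euler–Maclaurin in `y` at fixed `t`. Order `N + 1` gives `(t/n)^(N+1)`, and `n` unit intervals
cost a factor `n`. Since `N + 2 < a.re`, the last exponent has positive real part, so a base in `(0,
1]` has power at most `1` in norm: the error is uniform in `t` and survives integration. -/
theorem norm_segment_sum_sub_le (N : ℕ) : ∃ K : ℝ, 0 ≤ K ∧ ∀ (a : ℂ) (R t : ℝ) (n : ℕ),
    1 ≤ n → ‖a‖ ≤ R → N + 2 < a.re → t ∈ Set.Ioo (0 : ℝ) 1 →
    ‖∑ k ∈ Finset.range n, a * ((1 - t * (1 - k / n) : ℝ) : ℂ) ^ (a - 1)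
      - (n * ((1 - ((1 - t : ℝ) : ℂ) ^ a) / t)
        + ∑ i ∈ Finset.range (N + 1), (bernoulli (i + 1) : ℂ) / ((i + 1).factorial : ℂ) *
          (((n : ℂ) ^ i)⁻¹ * (ff a (i + 1) * ((t : ℂ) ^ i *
            (1 - ((1 - t : ℝ) : ℂ) ^ (a - 1 - i))))))‖ ≤
      K * (R + (N + 2 : ℕ)) ^ (N + 2) * ((n : ℝ) ^ N)⁻¹ := by
  obtain ⟨K, hK, h⟩ := euler_maclaurin_bound N
  refine ⟨K, hK, fun a R t n hn ha hre ht => ?_⟩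
  have hR : 0 ≤ R := (norm_nonneg a).trans ha
  have hn0 : (0 : ℝ) < n := by exact_mod_cast hn
  have hnC : (n : ℂ) ≠ 0 := by exact_mod_cast hn0.ne'
  have htC : (t : ℂ) ≠ 0 := by exact_mod_cast ht.1.ne'
  have hN0 : (0 : ℝ) ≤ N := by positivity
  have ha0 : a ≠ 0 := by
    rintro rfl
    simp at hre
    linarith
  have hpos : ∀ y ∈ Set.Icc (0 : ℝ) n, 0 < (1 - t) + t / n * y := by
    intro y hy
    have : 0 ≤ t / n * y := mul_nonneg (div_nonneg ht.1.le hn0.le) hy.1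
    linarith [ht.2]
  have hle : ∀ y ∈ Set.Icc (0 : ℝ) n, (1 - t) + t / n * y ≤ 1 := by
    intro y hy
    have : t / n * y ≤ t / n * n := mul_le_mul_of_nonneg_left hy.2 (div_nonneg ht.1.le hn0.le)
    rw [div_mul_cancel₀ _ hn0.ne'] at this
    linarith
  set f : ℕ → ℝ → ℂ := fun i y =>
    a * (ff (a - 1) i * ((t / n : ℝ) : ℂ) ^ i * (((1 - t) + t / n * y : ℝ) : ℂ) ^ (a - 1 - i)) with hf
  set A : ℝ → ℂ := fun y => n / t * (((1 - t) + t / n * y : ℝ) : ℂ) ^ a with hA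
  have hfd : ∀ i, ∀ y ∈ Set.Icc (0 : ℝ) n, HasDerivAt (f i) (f (i + 1) y) y := fun i y hy =>
    (hasDerivAt_affine_cpow (a - 1) (1 - t) (t / n) i (hpos y hy)).const_mul a
  have hAd : ∀ y ∈ Set.Icc (0 : ℝ) n, HasDerivAt A (f 0 y) y := by
    intro y hy
    have := (hasDerivAt_affine_cpow a (1 - t) (t / n) 0 (hpos y hy)).const_mul ((n : ℂ) / t)
    simp only [ff_zero, pow_zero, one_mul, Nat.cast_zero, sub_zero, zero_add, pow_one,
      ff_succ, Nat.cast_one] at this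
    convert! this using 1
    simp only [hf, ff_zero, pow_zero, one_mul, Nat.cast_zero, sub_zero]
    push_cast
    field_simp
  have key := h f A n ((R + (N + 2 : ℕ)) ^ (N + 2) * ((n : ℝ) ^ (N + 1))⁻¹) hAd hfd ?_
  · have e1 : ∀ k : ℕ, f 0 k = a * ((1 - t * (1 - k / n) : ℝ) : ℂ) ^ (a - 1) := by
      intro k
      simp only [hf, ff_zero, pow_zero, one_mul, Nat.cast_zero, sub_zero]
      rw [show 1 - t + t / n * k = 1 - t * (1 - k / n) by ring]
    have e2 : A n - A 0 = n * ((1 - ((1 - t : ℝ) : ℂ) ^ a) / t) := by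
      simp only [hA]
      rw [div_mul_cancel₀ _ hn0.ne', mul_zero, add_zero, sub_add_cancel, Complex.ofReal_one,
        Complex.one_cpow]
      ring
    have e3 : ∀ i : ℕ, f i n - f i 0 = ((n : ℂ) ^ i)⁻¹ * (ff a (i + 1) * ((t : ℂ) ^ i *
            (1 - ((1 - t : ℝ) : ℂ) ^ (a - 1 - i)))) := by
      intro i
      simp only [hf]
      rw [div_mul_cancel₀ _ hn0.ne', mul_zero, add_zero, sub_add_cancel, Complex.ofReal_one,
        Complex.one_cpow, ff_succ']
      push_cast
      rw [div_pow]
      ring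
    simp only [e1, e2, e3] at key
    refine key.trans (le_of_eq ?_)
    rw [pow_succ (n : ℝ) N]
    field_simp
  · intro y hy
    simp only [hf]
    rw [← mul_assoc, ← mul_assoc, ← ff_succ', norm_mul, norm_mul, norm_pow, Complex.norm_real,
      Real.norm_of_nonneg (div_nonneg ht.1.le hn0.le), mul_assoc]
    refine mul_le_mul (norm_ff_le ha _) ?_ (by have := ht.1; positivity) (by positivity)
    rw [Complex.norm_cpow_eq_rpow_re_of_pos (hpos y hy)]
    have h1 : (t / n) ^ (N + 1) ≤ ((n : ℝ) ^ (N + 1))⁻¹ := by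
      rw [← inv_pow, div_eq_mul_inv]
      have : 0 ≤ t := ht.1.le
      gcongr
      exact mul_le_of_le_one_left (by positivity) ht.2.le
    have h2 : ((1 - t) + t / n * y) ^ (a - 1 - ((N + 1 : ℕ) : ℂ)).re ≤ 1 := by
      refine Real.rpow_le_one (hpos y hy).le (hle y hy) ?_
      simp only [Complex.sub_re, Complex.one_re, Complex.natCast_re]
      push_cast
      linarith
    calc _ ≤ ((n : ℝ) ^ (N + 1))⁻¹ * 1 := mul_le_mul h1 h2
          (Real.rpow_nonneg (hpos y hy).le _) (by positivity)
      _ = _ := mul_one _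

theorem norm_sum_harm_sub_le (R : ℝ) (N : ℕ) : ∃ K : ℝ, 0 ≤ K ∧ ∀ (a : ℂ) (n : ℕ),
    1 ≤ n → ‖a‖ ≤ R → N + 2 < a.re →
    ‖∑ k ∈ Finset.range n, (1 - ((k / n : ℝ) : ℂ) ^ a) / (1 - (k / n : ℝ))
      - (n * harm a
        + ∑ i ∈ Finset.range (N + 1), (bernoulli (i + 1) : ℂ) / ((i + 1).factorial : ℂ) *
          (((n : ℂ) ^ i)⁻¹ * (ff a (i + 1) / (i + 1) - i.factorial)))‖ ≤
      K * ((n : ℝ) ^ N)⁻¹ := by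
  obtain ⟨K, hK, h⟩ := norm_segment_sum_sub_le N
  refine ⟨K * (max R 0 + (N + 2 : ℕ)) ^ (N + 2), by positivity, fun a n hn ha hre => ?_⟩
  have hn0 : (0 : ℝ) < n := by exact_mod_cast hn
  have hN0 : (0 : ℝ) ≤ N := by positivity
  have hsum : ∀ k ∈ Finset.range n, Continuous fun t : ℝ =>
      a * ((1 - t * (1 - k / n) : ℝ) : ℂ) ^ (a - 1) := fun k _ =>
    continuous_const.mul ((Complex.continuous_ofReal_cpow_const (y := a - 1)
      (by simpa using by linarith)).comp (by fun_prop))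
  have hbd : ∀ i ∈ Finset.range (N + 1), Continuous fun t : ℝ =>
      (bernoulli (i + 1) : ℂ) / ((i + 1).factorial : ℂ) *
          (((n : ℂ) ^ i)⁻¹ * (ff a (i + 1) * ((t : ℂ) ^ i *
            (1 - ((1 - t : ℝ) : ℂ) ^ (a - 1 - i))))) := by
    intro i hi
    have hi' : (i : ℝ) ≤ N := by exact_mod_cast Nat.lt_succ_iff.1 (Finset.mem_range.1 hi)
    have hc : Continuous fun t : ℝ => ((1 - t : ℝ) : ℂ) ^ (a - 1 - i) :=
      (Complex.continuous_ofReal_cpow_const (by simpa using by linarith)).comp (by fun_prop)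
    fun_prop
  have hI1 : ∫ t : ℝ in 0..1, ∑ k ∈ Finset.range n, a * ((1 - t * (1 - k / n) : ℝ) : ℂ) ^ (a - 1)
      = ∑ k ∈ Finset.range n, (1 - ((k / n : ℝ) : ℂ) ^ a) / (1 - (k / n : ℝ)) := by
    rw [intervalIntegral.integral_finsetSum fun k hk => (hsum k hk).intervalIntegrable _ _]
    refine Finset.sum_congr rfl fun k hk => ?_
    have : (k : ℝ) < n := by exact_mod_cast Finset.mem_range.1 hk
    exact integral_cpow_segment (by linarith) ((div_lt_one hn0).2 this) (by positivity)
  have hI2 : ∫ t : ℝ in 0..1, (n : ℂ) * ((1 - ((1 - t : ℝ) : ℂ) ^ a) / t) = n * harm a :=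
    intervalIntegral.integral_const_mul _ _
  have hI3 : ∫ t : ℝ in 0..1, ∑ i ∈ Finset.range (N + 1),
      (bernoulli (i + 1) : ℂ) / ((i + 1).factorial : ℂ) *
          (((n : ℂ) ^ i)⁻¹ * (ff a (i + 1) * ((t : ℂ) ^ i *
            (1 - ((1 - t : ℝ) : ℂ) ^ (a - 1 - i))))) =
      ∑ i ∈ Finset.range (N + 1), (bernoulli (i + 1) : ℂ) / ((i + 1).factorial : ℂ) *
          (((n : ℂ) ^ i)⁻¹ * (ff a (i + 1) / (i + 1) - i.factorial)) := by
    rw [intervalIntegral.integral_finsetSum fun k hk => (hbd k hk).intervalIntegrable _ _]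
    refine Finset.sum_congr rfl fun i hi => ?_
    have hi' : (i : ℝ) ≤ N := by exact_mod_cast Nat.lt_succ_iff.1 (Finset.mem_range.1 hi)
    rw [intervalIntegral.integral_const_mul, intervalIntegral.integral_const_mul,
      integral_boundary (by linarith)]
  have hi1 := (continuous_finsetSum _ hsum).intervalIntegrable (μ := MeasureTheory.volume) 0 1
  have hi2 := (intervalIntegrable_harm (a := a) (by linarith)).const_mul (n : ℂ)
  have hi3 := (continuous_finsetSum _ hbd).intervalIntegrable (μ := MeasureTheory.volume) 0 1
  rw [← hI1, ← hI2, ← hI3, ← intervalIntegral.integral_add hi2 hi3,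
    ← intervalIntegral.integral_sub hi1 (hi2.add hi3)]
  refine (intervalIntegral.norm_integral_le_of_norm_le_const_ae
    (C := K * (max R 0 + (N + 2 : ℕ)) ^ (N + 2) * ((n : ℝ) ^ N)⁻¹) ?_).trans (by simp)
  -- At `t = 1` the base vanishes at `y = 0` and the pointwise bound is not available; one point
  -- does not affect the integral.
  have hne : ∀ᵐ t : ℝ, t ≠ 1 := by simp [MeasureTheory.ae_iff]
  filter_upwards [hne] with t ht1 ht
  rw [Set.uIoc_of_le zero_le_one] at ht
  exact h a (max R 0) t n hn (ha.trans (le_max_left _ _)) hre ⟨ht.1, lt_of_le_of_ne ht.2 ht1⟩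

/-! ### Expansion of the sum with a complex exponent. -/

/-- `∑_{k=1}^{n-1} k^z / (n-k)`. -/
noncomputable def convSum (z : ℂ) (n : ℕ) : ℂ :=
  ∑ k ∈ Finset.Ico 1 n, (k : ℂ) ^ z / ((n : ℂ) - k)

theorem ff_neg_one (i : ℕ) : ff (-1) i = (-1) ^ i * i.factorial := by
  induction i with
  | zero => simp [ff_zero]
  | succ i ih => rw [ff_succ, ih, Nat.factorial_succ]; push_cast; ring

/-- The corrections of the harmonic number are the `i!` boundary parts of the Riemann sum with
opposite sign, except for `B_1`, whose two equal contributions `-1/(2n)` are compensated by `1/n`.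
-/
theorem emCorr_neg_one_add (N : ℕ) {n : ℕ} (hn : 1 ≤ n) :
    emCorr (-1) (N + 1) n + (n : ℂ)⁻¹ + ∑ i ∈ Finset.range (N + 1),
      (bernoulli (i + 1) : ℂ) / ((i + 1).factorial : ℂ) * (i.factorial * ((n : ℂ) ^ (i + 1))⁻¹)
      = 0 := by
  have hn0 : (n : ℂ) ≠ 0 := by exact_mod_cast (by omega : n ≠ 0)
  have hp : ∀ i : ℕ, (n : ℂ) ^ (-1 - i : ℂ) = ((n : ℂ) ^ (i + 1))⁻¹ := by
    intro i
    rw [show (-1 - i : ℂ) = -((i + 1 : ℕ) : ℂ) by push_cast; ring, Complex.cpow_neg,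
      Complex.cpow_natCast]
  induction N with
  | zero =>
    simp [emCorr, ff_zero, bernoulli_one, Complex.cpow_neg_one]
    ring
  | succ N ih =>
    rw [Finset.sum_range_succ, emCorr, Finset.sum_range_succ, ← emCorr, hp, ff_neg_one]
    have h3 := neg_one_pow_mul_bernoulli (k := N + 2) (by omega)
    have h4 : (-1) ^ (N + 2) * (bernoulli (N + 1 + 1) : ℂ) = (bernoulli (N + 1 + 1) : ℂ) := by
      exact_mod_cast h3
    have h5 : (-1 : ℂ) ^ (N + 1) * (bernoulli (N + 1 + 1) : ℂ) = -(bernoulli (N + 1 + 1) : ℂ) := by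
      linear_combination -h4
    linear_combination ih + 1 / ((N + 1 + 1).factorial : ℂ) * ((N + 1).factorial : ℂ) *
      ((n : ℂ) ^ (N + 1 + 1))⁻¹ * h5

theorem sum_one_div_sub (n : ℕ) :
    ∑ k ∈ Finset.Ico 1 n, 1 / ((n : ℂ) - k) = powSum (-1) n := by
  have h := Finset.sum_Ico_reflect (fun k : ℕ => (k : ℂ) ^ (-1 : ℂ)) 1 (m := n) (n := n) (by omega)
  rw [Nat.add_sub_cancel_left, Nat.add_sub_cancel] at h
  rw [powSum, ← h]
  refine Finset.sum_congr rfl fun k hk => ?_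
  rw [Complex.cpow_neg_one, Nat.cast_sub (Finset.mem_Ico.1 hk).2.le, one_div]

/-- With `x = k/n`, split `x^a = 1 - (1 - x^a)`. The extra `1/n` offsets the term `k = 0` of the
Riemann sum. -/
theorem convSum_eq {a : ℂ} (ha : a ≠ 0) {n : ℕ} (hn : 1 ≤ n) :
    convSum a n = (n : ℂ) ^ a * (powSum (-1) n + (n : ℂ)⁻¹ - (n : ℂ)⁻¹ *
      ∑ k ∈ Finset.range n, (1 - ((k / n : ℝ) : ℂ) ^ a) / (1 - (k / n : ℝ))) := by
  have hn0 : (0 : ℝ) < n := by exact_mod_cast hn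
  have hnC : (n : ℂ) ≠ 0 := by exact_mod_cast hn0.ne'
  rw [Finset.range_eq_Ico, Finset.sum_eq_sum_Ico_succ_bot (by omega), ← sum_one_div_sub]
  simp only [Nat.cast_zero, zero_div, Complex.ofReal_zero, Complex.zero_cpow ha, sub_zero, div_one,
    zero_add]
  rw [mul_add, mul_one, add_comm (n : ℂ)⁻¹, add_sub_add_right_eq_sub, Finset.mul_sum, ← Finset.sum_sub_distrib,
    Finset.mul_sum, convSum]
  refine Finset.sum_congr rfl fun k hk => ?_
  have hk' : (k : ℝ) < n := by exact_mod_cast (Finset.mem_Ico.1 hk).2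
  have hkC : (n : ℂ) - k ≠ 0 := by exact_mod_cast (sub_pos.2 hk').ne'
  have e : (k : ℂ) ^ a = (n : ℂ) ^ a * ((k / n : ℝ) : ℂ) ^ a := by
    have := Complex.mul_cpow_ofReal_nonneg hn0.le (div_nonneg (Nat.cast_nonneg k) hn0.le) a
    rw [← Complex.ofReal_natCast n, ← this, ← Complex.ofReal_mul, mul_div_cancel₀ _ hn0.ne',
      Complex.ofReal_natCast]
  rw [e]
  generalize ((k / n : ℝ) : ℂ) ^ a = X
  have e2 : (1 : ℂ) - ((k / n : ℝ) : ℂ) = (n - k) / n := by push_cast; field_simp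
  rw [e2]
  field_simp
  ring

/-- The expansion of `convSum a n` when `a` has large real part. -/
theorem norm_convSum_sub_le_of_re (R : ℝ) (N : ℕ) : ∃ K : ℝ, 0 ≤ K ∧ ∀ (a : ℂ) (n : ℕ),
    1 ≤ n → ‖a‖ ≤ R → N + 2 < a.re →
    ‖convSum a n - (n : ℂ) ^ a * (Real.log n + Real.eulerMascheroniConstant - harm a
      - ∑ i ∈ Finset.range (N + 1), (bernoulli (i + 1) : ℂ) / ((i + 1).factorial : ℂ) *
          (ff a (i + 1) / (i + 1) * ((n : ℂ) ^ (i + 1))⁻¹))‖ ≤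
      K * (n : ℝ) ^ (a.re - (N + 1)) := by
  obtain ⟨K₁, hK₁, h₁⟩ := norm_powSum_neg_one_sub_le (N + 1)
  obtain ⟨K₂, hK₂, h₂⟩ := norm_sum_harm_sub_le R N
  refine ⟨K₁ + K₂, by positivity, fun a n hn ha hre => ?_⟩
  have hn0 : (0 : ℝ) < n := by exact_mod_cast hn
  have hnC : (n : ℂ) ≠ 0 := by exact_mod_cast hn0.ne'
  have hN0 : (0 : ℝ) ≤ N := by positivity
  have ha0 : a ≠ 0 := by
    rintro rfl
    simp at hre
    linarith
  rw [convSum_eq ha0 hn, ← mul_sub, norm_mul, Complex.norm_natCast_cpow_of_pos hn]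
  specialize h₁ n hn
  specialize h₂ a n hn ha hre
  set Q := ∑ k ∈ Finset.range n, (1 - ((k / n : ℝ) : ℂ) ^ a) / (1 - (k / n : ℝ))
  have hpar := emCorr_neg_one_add N hn
  have e : powSum (-1) n + (n : ℂ)⁻¹ - (n : ℂ)⁻¹ * Q -
      (Real.log n + Real.eulerMascheroniConstant - harm a
      - ∑ i ∈ Finset.range (N + 1), (bernoulli (i + 1) : ℂ) / ((i + 1).factorial : ℂ) *
          (ff a (i + 1) / (i + 1) * ((n : ℂ) ^ (i + 1))⁻¹)) =
      (powSum (-1) n - (Real.eulerMascheroniConstant + Real.log n + emCorr (-1) (N + 1) n))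
      - (n : ℂ)⁻¹ * (Q - (n * harm a
        + ∑ i ∈ Finset.range (N + 1), (bernoulli (i + 1) : ℂ) / ((i + 1).factorial : ℂ) *
          (((n : ℂ) ^ i)⁻¹ * (ff a (i + 1) / (i + 1) - i.factorial)))) := by
    have e1 : (n : ℂ)⁻¹ * ∑ i ∈ Finset.range (N + 1),
        (bernoulli (i + 1) : ℂ) / ((i + 1).factorial : ℂ) *
          (((n : ℂ) ^ i)⁻¹ * (ff a (i + 1) / (i + 1) - i.factorial)) =
        ∑ i ∈ Finset.range (N + 1), (bernoulli (i + 1) : ℂ) / ((i + 1).factorial : ℂ) *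
          (ff a (i + 1) / (i + 1) * ((n : ℂ) ^ (i + 1))⁻¹) -
        ∑ i ∈ Finset.range (N + 1), (bernoulli (i + 1) : ℂ) / ((i + 1).factorial : ℂ) *
          (i.factorial * ((n : ℂ) ^ (i + 1))⁻¹) := by
      rw [Finset.mul_sum, ← Finset.sum_sub_distrib]
      refine Finset.sum_congr rfl fun i _ => ?_
      rw [pow_succ, mul_inv]
      ring
    have e2 : (n : ℂ)⁻¹ * (n * harm a) = harm a := inv_mul_cancel_left₀ hnC _
    linear_combination -e1 - e2 + hpar
  rw [e, Real.rpow_sub hn0, mul_comm (K₁ + K₂), div_mul_eq_mul_div, mul_div_assoc]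
  refine mul_le_mul_of_nonneg_left ?_ (by positivity)
  refine (norm_sub_le _ _).trans ?_
  rw [norm_mul, norm_inv, Complex.norm_natCast]
  have hpow : (n : ℝ) ^ ((N : ℝ) + 1) = (n : ℝ) ^ N * n := by
    rw [Real.rpow_add_one hn0.ne', Real.rpow_natCast]
  have h3 : (n : ℝ)⁻¹ * ‖Q - (n * harm a
        + ∑ i ∈ Finset.range (N + 1), (bernoulli (i + 1) : ℂ) / ((i + 1).factorial : ℂ) *
          (((n : ℂ) ^ i)⁻¹ * (ff a (i + 1) / (i + 1) - i.factorial)))‖ ≤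
      K₂ / (n : ℝ) ^ ((N : ℝ) + 1) := by
    calc _ ≤ (n : ℝ)⁻¹ * (K₂ * ((n : ℝ) ^ N)⁻¹) := by gcongr
      _ = _ := by rw [hpow]; field_simp
  have h4 : K₁ * (n : ℝ) ^ (-1 - ((N + 1 : ℕ) : ℝ)) ≤ K₁ / (n : ℝ) ^ ((N : ℝ) + 1) := by
    rw [div_eq_mul_inv, ← Real.rpow_neg hn0.le]
    gcongr
    · exact_mod_cast hn
    · push_cast; linarith
  rw [add_div]
  exact add_le_add (h₁.trans h4) h3

/-- Expand `1/(n-k)` as `M` terms of a geometric series plus its exact tail, which raises the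
exponent by `M`. -/
theorem convSum_eq_sum_add (z : ℂ) (M : ℕ) {n : ℕ} (hn : 1 ≤ n) :
    convSum z n = ∑ j ∈ Finset.range M, ((n : ℂ) ^ (j + 1))⁻¹ * powSum (z + j) n
      + ((n : ℂ) ^ M)⁻¹ * convSum (z + M) n := by
  have hnC : (n : ℂ) ≠ 0 := by exact_mod_cast (by omega : n ≠ 0)
  induction M with
  | zero => simp
  | succ M ih =>
    rw [ih, Finset.sum_range_succ, add_assoc]
    congr 1
    simp only [convSum, powSum, Finset.mul_sum]
    rw [← Finset.sum_add_distrib]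
    refine Finset.sum_congr rfl fun k hk => ?_
    have hk' : (k : ℝ) < n := by exact_mod_cast (Finset.mem_Ico.1 hk).2
    have hkC : (n : ℂ) - k ≠ 0 := by exact_mod_cast (sub_pos.2 hk').ne'
    have hk0 : (k : ℂ) ≠ 0 := by
      have := (Finset.mem_Ico.1 hk).1
      exact_mod_cast (by omega : k ≠ 0)
    have e : (k : ℂ) ^ (z + (M + 1 : ℕ)) = (k : ℂ) ^ (z + M) * k := by
      rw [Nat.cast_add, Nat.cast_one, ← add_assoc, Complex.cpow_add _ _ hk0, Complex.cpow_one]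
    rw [e]
    field_simp
    ring

/-- Telescoping: `ff · (i+1)` has forward difference `(i+1) ff · i`. -/
theorem sum_ff (z : ℂ) (M i : ℕ) :
    ∑ j ∈ Finset.range M, ff (z + j) i = (ff (z + M) (i + 1) - ff z (i + 1)) / (i + 1) := by
  have hi : (i : ℂ) + 1 ≠ 0 := by exact_mod_cast i.succ_ne_zero
  rw [eq_div_iff hi]
  induction M with
  | zero => simp
  | succ M ih =>
    rw [Finset.sum_range_succ, add_mul, ih]
    have := ff_add_one_sub (z + M) i
    push_cast
    rw [← add_assoc]
    linear_combination -this

/-- The shift `N + 3` makes the real part of the tail exponent exceed `N + 2`. The falling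
factorials of `z + (N + 3)` from the tail cancel those from the power sums. The natural error
`n^(z.re - (N+1))` is weakened to `n^(-N)`, since `n^z` may grow like `n^(1/2)`. -/
theorem norm_convSum_sub_le_harm (N : ℕ) : ∃ K : ℝ, 0 ≤ K ∧ ∀ (z : ℂ) (n : ℕ),
    1 ≤ n → ‖z‖ ≤ 1 / 2 →
    ‖convSum z n - (∑ j ∈ Finset.range (N + 3), riemannZeta (-(z + j)) * ((n : ℂ) ^ (j + 1))⁻¹
      + (n : ℂ) ^ z * (Real.log n + Real.eulerMascheroniConstant
        + (∑ j ∈ Finset.range (N + 3), 1 / (z + j + 1) - harm (z + (N + 3 : ℕ)))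
        - ∑ i ∈ Finset.range (N + 1), (bernoulli (i + 1) : ℂ) / ((i + 1).factorial : ℂ) *
            (ff z (i + 1) / (i + 1) * ((n : ℂ) ^ (i + 1))⁻¹)))‖ ≤
      K * ((n : ℝ) ^ N)⁻¹ := by
  obtain ⟨K₁, hK₁, h₁⟩ := norm_powSum_sub_le (N + 4) (N + 1)
  obtain ⟨K₂, hK₂, h₂⟩ := norm_convSum_sub_le_of_re (N + 4) N
  refine ⟨(N + 3 : ℕ) * K₁ + K₂, by positivity, fun z n hn hz => ?_⟩
  have hn0 : (0 : ℝ) < n := by exact_mod_cast hn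
  have hn1 : (1 : ℝ) ≤ n := by exact_mod_cast hn
  have hnC : (n : ℂ) ≠ 0 := by exact_mod_cast hn0.ne'
  have hzre := (Complex.abs_re_le_norm z).trans hz
  rw [abs_le] at hzre
  have hnorm : ∀ j : ℕ, j ≤ N + 3 → ‖z + j‖ ≤ N + 4 := by
    intro j hj
    have : (j : ℝ) ≤ N + 3 := by exact_mod_cast hj
    refine (norm_add_le _ _).trans ?_
    rw [Complex.norm_natCast]
    linarith
  have hne : ∀ j : ℕ, z + j + 1 ≠ 0 := by
    intro j h
    have := congrArg Complex.re h
    simp at this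
    have hj : (0 : ℝ) ≤ j := by positivity
    linarith [hzre.1]
  set b : ℕ → ℂ := fun i => (bernoulli (i + 1) : ℂ) / ((i + 1).factorial : ℂ) with hb
  have hcpow : ∀ (j : ℕ) (w : ℂ), (n : ℂ) ^ (w + j) = (n : ℂ) ^ w * (n : ℂ) ^ j := by
    intro j w
    rw [Complex.cpow_add _ _ hnC, Complex.cpow_natCast]
  have e1 : ∀ j : ℕ, ((n : ℂ) ^ (j + 1))⁻¹ * ((n : ℂ) ^ (z + j + 1) / (z + j + 1)) =
      (n : ℂ) ^ z * (1 / (z + j + 1)) := by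
    intro j
    have := hcpow (j + 1) z
    push_cast at this
    rw [← add_assoc] at this
    rw [this]
    field_simp
  have e2 : ∀ j : ℕ, ((n : ℂ) ^ (j + 1))⁻¹ * emCorr (z + j) (N + 1) n =
      (n : ℂ) ^ z * ∑ i ∈ Finset.range (N + 1), b i * (ff (z + j) i * ((n : ℂ) ^ (i + 1))⁻¹) := by
    intro j
    rw [emCorr, Finset.mul_sum, Finset.mul_sum]
    refine Finset.sum_congr rfl fun i _ => ?_
    rw [Complex.cpow_sub _ _ hnC, hcpow, Complex.cpow_natCast, pow_succ, pow_succ]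
    simp only [hb]
    field_simp
  have e3 : ∑ j ∈ Finset.range (N + 3), ∑ i ∈ Finset.range (N + 1),
        b i * (ff (z + j) i * ((n : ℂ) ^ (i + 1))⁻¹) =
      ∑ i ∈ Finset.range (N + 1), b i * (ff (z + (N + 3 : ℕ)) (i + 1) / (i + 1) *
        ((n : ℂ) ^ (i + 1))⁻¹) -
      ∑ i ∈ Finset.range (N + 1), b i * (ff z (i + 1) / (i + 1) * ((n : ℂ) ^ (i + 1))⁻¹) := by
    rw [Finset.sum_comm, ← Finset.sum_sub_distrib]
    refine Finset.sum_congr rfl fun i _ => ?_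
    rw [← Finset.mul_sum, ← Finset.sum_mul, sum_ff]
    ring
  have e4 : ((n : ℂ) ^ (N + 3))⁻¹ * (n : ℂ) ^ (z + (N + 3 : ℕ)) = (n : ℂ) ^ z := by
    rw [hcpow]
    field_simp
  set P : ℕ → ℂ := fun j => powSum (z + j) n - (riemannZeta (-(z + j)) +
    (n : ℂ) ^ (z + j + 1) / (z + j + 1) + emCorr (z + j) (N + 1) n) with hP
  set T := convSum (z + (N + 3 : ℕ)) n - (n : ℂ) ^ (z + (N + 3 : ℕ)) * (Real.log n
    + Real.eulerMascheroniConstant - harm (z + (N + 3 : ℕ)) - ∑ i ∈ Finset.range (N + 1),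
      b i * (ff (z + (N + 3 : ℕ)) (i + 1) / (i + 1) * ((n : ℂ) ^ (i + 1))⁻¹)) with hT
  have e : convSum z n - (∑ j ∈ Finset.range (N + 3), riemannZeta (-(z + j)) *
        ((n : ℂ) ^ (j + 1))⁻¹
      + (n : ℂ) ^ z * (Real.log n + Real.eulerMascheroniConstant
        + (∑ j ∈ Finset.range (N + 3), 1 / (z + j + 1) - harm (z + (N + 3 : ℕ)))
        - ∑ i ∈ Finset.range (N + 1), b i * (ff z (i + 1) / (i + 1) * ((n : ℂ) ^ (i + 1))⁻¹))) =
      ∑ j ∈ Finset.range (N + 3), ((n : ℂ) ^ (j + 1))⁻¹ * P j + ((n : ℂ) ^ (N + 3))⁻¹ * T := by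
    have e5 : ∑ j ∈ Finset.range (N + 3), ((n : ℂ) ^ (j + 1))⁻¹ * P j =
        ∑ j ∈ Finset.range (N + 3), ((n : ℂ) ^ (j + 1))⁻¹ * powSum (z + j) n
        - ∑ j ∈ Finset.range (N + 3), riemannZeta (-(z + j)) * ((n : ℂ) ^ (j + 1))⁻¹
        - (n : ℂ) ^ z * ∑ j ∈ Finset.range (N + 3), 1 / (z + j + 1)
        - (n : ℂ) ^ z * ∑ j ∈ Finset.range (N + 3), ∑ i ∈ Finset.range (N + 1),
          b i * (ff (z + j) i * ((n : ℂ) ^ (i + 1))⁻¹) := by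
      rw [Finset.mul_sum, Finset.mul_sum, ← Finset.sum_sub_distrib, ← Finset.sum_sub_distrib,
        ← Finset.sum_sub_distrib]
      refine Finset.sum_congr rfl fun j _ => ?_
      rw [← e1, ← e2]
      simp only [hP]
      ring
    rw [e5, e3, convSum_eq_sum_add z (N + 3) hn, hT]
    linear_combination (Real.log n
      + Real.eulerMascheroniConstant - harm (z + (N + 3 : ℕ)) - ∑ i ∈ Finset.range (N + 1),
      b i * (ff (z + (N + 3 : ℕ)) (i + 1) / (i + 1) * ((n : ℂ) ^ (i + 1))⁻¹)) * e4
  rw [e]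
  have hpowle : (n : ℝ) ^ (z.re - (N + 1)) ≤ ((n : ℝ) ^ N)⁻¹ := by
    rw [← Real.rpow_natCast, ← Real.rpow_neg hn0.le]
    exact Real.rpow_le_rpow_of_exponent_le hn1 (by linarith)
  have hb1 : ∀ j ∈ Finset.range (N + 3), ‖((n : ℂ) ^ (j + 1))⁻¹ * P j‖ ≤ K₁ * ((n : ℝ) ^ N)⁻¹ := by
    intro j hj
    have h := h₁ (z + j) n hn (hnorm j (Finset.mem_range.1 hj).le)
      (fun h => hne j (by rw [h]; ring))
    rw [norm_mul, norm_inv, norm_pow, Complex.norm_natCast]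
    calc _ ≤ ((n : ℝ) ^ (j + 1))⁻¹ * (K₁ * (n : ℝ) ^ ((z + j).re - ((N + 1 : ℕ) : ℝ))) := by gcongr
      _ ≤ ((n : ℝ) ^ j)⁻¹ * (K₁ * (n : ℝ) ^ ((z + j).re - ((N + 1 : ℕ) : ℝ))) := by
        gcongr
        omega
      _ = K₁ * (n : ℝ) ^ (z.re - (N + 1)) := by
        rw [Complex.add_re, Complex.natCast_re, add_sub_right_comm, Real.rpow_add_natCast hn0.ne']
        push_cast
        field_simp
      _ ≤ _ := by gcongr
  have hb2 : ‖((n : ℂ) ^ (N + 3))⁻¹ * T‖ ≤ K₂ * ((n : ℝ) ^ N)⁻¹ := by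
    have h := h₂ (z + (N + 3 : ℕ)) n hn (hnorm (N + 3) le_rfl) (by
      rw [Complex.add_re, Complex.natCast_re]; push_cast; linarith)
    rw [norm_mul, norm_inv, norm_pow, Complex.norm_natCast]
    calc _ ≤ ((n : ℝ) ^ (N + 3))⁻¹ * (K₂ * (n : ℝ) ^ ((z + (N + 3 : ℕ)).re - (N + 1))) := by gcongr
      _ = K₂ * (n : ℝ) ^ (z.re - (N + 1)) := by
        rw [Complex.add_re, Complex.natCast_re, add_sub_right_comm, Real.rpow_add_natCast hn0.ne']
        field_simp
      _ ≤ _ := by gcongr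
  refine (norm_add_le _ _).trans ?_
  rw [add_mul]
  refine add_le_add ((norm_sum_le _ _).trans ?_) hb2
  refine (Finset.sum_le_card_nsmul _ _ _ hb1).trans (le_of_eq ?_)
  rw [Finset.card_range, nsmul_eq_mul, mul_assoc]

/-! ### The power series of `-ψ(1+z)`. -/

section PowerSeries

variable {c : ℕ → ℂ} {B : ℝ}

theorem hasFPowerSeriesOnBall_of_bounded (hc : ∀ r, ‖c r‖ ≤ B) :
    HasFPowerSeriesOnBall (fun z : ℂ => ∑' r, c r * z ^ r)
      (FormalMultilinearSeries.ofScalars ℂ c) 0 1 := by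
  have hr : (1 : ENNReal) ≤ (FormalMultilinearSeries.ofScalars ℂ c).radius := by
    have := (FormalMultilinearSeries.ofScalars ℂ c).le_radius_of_bound (r := 1) B (fun n => by
      simpa [FormalMultilinearSeries.ofScalars_norm] using hc n)
    simpa using this
  have h := (FormalMultilinearSeries.ofScalars ℂ c).hasFPowerSeriesOnBall
    (zero_lt_one.trans_le hr)
  have e : (FormalMultilinearSeries.ofScalars ℂ c).sum = fun z : ℂ => ∑' r, c r * z ^ r := by
    have := FormalMultilinearSeries.ofScalarsSum_eq_tsum (E := ℂ) c
    simpa [FormalMultilinearSeries.ofScalarsSum, smul_eq_mul] using this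
  rw [e] at h
  exact h.mono one_pos hr

theorem iteratedDeriv_tsum_zero (hc : ∀ r, ‖c r‖ ≤ B) (n : ℕ) :
    iteratedDeriv n (fun z : ℂ => ∑' r, c r * z ^ r) 0 = n.factorial * c n := by
  rw [iteratedDeriv_eq_iteratedFDeriv, ← (hasFPowerSeriesOnBall_of_bounded hc).factorial_smul]
  simp [FormalMultilinearSeries.ofScalars, nsmul_eq_mul]

theorem differentiableOn_tsum_ball (hc : ∀ r, ‖c r‖ ≤ B) :
    DifferentiableOn ℂ (fun z : ℂ => ∑' r, c r * z ^ r) (Metric.ball 0 1) := by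
  have := (hasFPowerSeriesOnBall_of_bounded hc).differentiableOn
  rwa [← ENNReal.ofReal_one, Metric.eball_ofReal] at this

end PowerSeries

/-- The Taylor coefficients of `γ - ∑_{l ≥ 1} (1/l - 1/(z+l))` at `z = 0`. -/
noncomputable def digammaCoeff (r : ℕ) : ℂ :=
  if r = 0 then (Real.eulerMascheroniConstant : ℂ) else (-1) ^ r * riemannZeta ((r : ℂ) + 1)

/-- The power series of `γ - ∑_{l ≥ 1} (1/l - 1/(z+l))`. -/
noncomputable def digammaSeries (z : ℂ) : ℂ := ∑' r, digammaCoeff r * z ^ r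

theorem summable_inv_sq : Summable fun l : ℕ => 1 / ((l : ℝ) + 1) ^ 2 := by
  have := (summable_nat_add_iff 1).2 (Real.summable_one_div_nat_pow.2 one_lt_two)
  simpa using this

theorem riemannZeta_nat_add_two (r : ℕ) :
    riemannZeta (((r + 1 : ℕ) : ℂ) + 1) = ∑' l : ℕ, 1 / ((l : ℂ) + 1) ^ (r + 2) := by
  rw [show ((r + 1 : ℕ) : ℂ) + 1 = ((r + 2 : ℕ) : ℂ) by push_cast; ring,
    zeta_eq_tsum_one_div_nat_add_one_cpow (by simp; linarith [(Nat.cast_nonneg r : (0 : ℝ) ≤ r)])]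
  simp_rw [Complex.cpow_natCast]

theorem norm_natCast_add_one (l : ℕ) : ‖(l : ℂ) + 1‖ = l + 1 := by
  rw [← Nat.cast_add_one, Complex.norm_natCast, Nat.cast_add_one]

theorem norm_one_div_pow_le (l r : ℕ) :
    ‖1 / ((l : ℂ) + 1) ^ (r + 2)‖ ≤ 1 / ((l : ℝ) + 1) ^ 2 := by
  rw [norm_div, norm_one, norm_pow, norm_natCast_add_one]
  gcongr
  · linarith [(Nat.cast_nonneg l : (0 : ℝ) ≤ l)]
  · omega

theorem exists_digammaCoeff_bound : ∃ B : ℝ, ∀ r, ‖digammaCoeff r‖ ≤ B := by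
  refine ⟨max ‖(Real.eulerMascheroniConstant : ℂ)‖ (∑' l : ℕ, 1 / ((l : ℝ) + 1) ^ 2), fun r => ?_⟩
  rcases r with _ | r
  · simp [digammaCoeff]
  · rw [digammaCoeff, if_neg r.succ_ne_zero, norm_mul, norm_pow, norm_neg, norm_one, one_pow,
      one_mul, riemannZeta_nat_add_two]
    exact (tsum_of_norm_bounded summable_inv_sq.hasSum fun l => norm_one_div_pow_le l r).trans
      (le_max_right _ _)

/-- Expand each term geometrically in `z` and exchange the summations; the columns are zeta values
at integers. Absolute convergence comes from `1/(l+1)^2` times a geometric series of ratio `1/2`. -/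
theorem hasSum_digammaSeries {z : ℂ} (hz : ‖z‖ ≤ 1 / 2) :
    HasSum (fun l : ℕ => 1 / (z + l + 1) - 1 / ((l : ℂ) + 1))
      (digammaSeries z - Real.eulerMascheroniConstant) := by
  set F : ℕ × ℕ → ℂ := fun x => (-z) ^ (x.2 + 1) * (1 / ((x.1 : ℂ) + 1) ^ (x.2 + 2)) with hF
  have hgeo : Summable fun r : ℕ => (1 / 2 : ℝ) ^ (r + 1) :=
    (summable_nat_add_iff 1).2 (summable_geometric_of_lt_one (by norm_num) (by norm_num))
  have hsum : Summable F := by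
    refine Summable.of_norm_bounded (summable_inv_sq.mul_of_nonneg hgeo
      (fun l => by positivity) (fun r => by positivity)) fun x => ?_
    rw [norm_mul, norm_pow, norm_neg, mul_comm]
    exact mul_le_mul (norm_one_div_pow_le _ _) (pow_le_pow_left₀ (norm_nonneg _) hz _)
      (by positivity) (by positivity)
  have hrow : ∀ l : ℕ, HasSum (fun r => F (l, r)) (1 / (z + l + 1) - 1 / ((l : ℂ) + 1)) := by
    intro l
    have hl : ((l : ℂ) + 1) ≠ 0 := by exact_mod_cast l.succ_ne_zero
    have hln : (1 : ℝ) ≤ ‖(l : ℂ) + 1‖ := by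
      rw [norm_natCast_add_one]
      linarith [(Nat.cast_nonneg l : (0 : ℝ) ≤ l)]
    have hq : ‖-z / ((l : ℂ) + 1)‖ < 1 := by
      rw [norm_div, norm_neg, div_lt_one (by linarith)]
      linarith
    have hne : z + l + 1 ≠ 0 := by
      intro h
      have : (l : ℂ) + 1 = -z := by linear_combination h
      rw [this, norm_neg] at hln
      linarith
    have h := (hasSum_geometric_of_norm_lt_one hq).mul_left (-z / ((l : ℂ) + 1) ^ 2)
    convert! h using 1
    · ext r
      simp only [hF]
      rw [div_pow]
      field_simp
      ring
    · have : 1 - -z / ((l : ℂ) + 1) = (z + l + 1) / (l + 1) := by field_simp; ring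
      rw [this]
      field_simp
      ring
  have hcol : ∀ r : ℕ, HasSum (fun l => F (l, r)) (digammaCoeff (r + 1) * z ^ (r + 1)) := by
    intro r
    have hs : Summable fun l : ℕ => 1 / ((l : ℂ) + 1) ^ (r + 2) :=
      Summable.of_norm_bounded summable_inv_sq fun l => norm_one_div_pow_le l r
    convert! hs.hasSum.mul_left ((-z) ^ (r + 1)) using 1
    rw [digammaCoeff, if_neg r.succ_ne_zero, riemannZeta_nat_add_two, neg_pow z]
    ring
  have h1 := hsum.hasSum.prod_fiberwise hrow
  have hswap : HasSum (fun x : ℕ × ℕ => F (x.2, x.1)) (∑' x, F x) :=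
    (Equiv.prodComm ℕ ℕ).hasSum_iff.2 hsum.hasSum
  have h2 : HasSum (fun r : ℕ => digammaCoeff (r + 1) * z ^ (r + 1)) (∑' x, F x) :=
    hswap.prod_fiberwise hcol
  have h3 : digammaSeries z = Real.eulerMascheroniConstant + ∑' x, F x := by
    have hs : Summable fun r : ℕ => digammaCoeff r * z ^ r :=
      (summable_nat_add_iff (f := fun r : ℕ => digammaCoeff r * z ^ r) 1).1 h2.summable
    rw [digammaSeries, hs.tsum_eq_zero_add, h2.tsum_eq, pow_zero, mul_one, digammaCoeff,
      if_pos rfl]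
  rwa [h3, add_sub_cancel_left]

/-- Write `1/t` as a geometric series in `1 - t`, cut at `L`. The remaining integrand is at most
`‖a‖ (1-t)^L`. -/
theorem norm_harm_sub_le {a : ℂ} (ha : 1 < a.re) (L : ℕ) :
    ‖harm a - ∑ l ∈ Finset.range L, (1 / ((l : ℂ) + 1) - 1 / (a + l + 1))‖ ≤ ‖a‖ / (L + 1) := by
  have hc : Continuous fun t : ℝ => ((1 - t : ℝ) : ℂ) ^ a :=
    (Complex.continuous_ofReal_cpow_const (y := a) (by linarith)).comp (by fun_prop)
  have hterm : ∀ l : ℕ, ∫ t : ℝ in 0..1, ((1 - t : ℝ) : ℂ) ^ l * (1 - ((1 - t : ℝ) : ℂ) ^ a) =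
      1 / ((l : ℂ) + 1) - 1 / (a + l + 1) := by
    intro l
    have hre : -1 < (a + l).re := by
      simp only [Complex.add_re, Complex.natCast_re]
      linarith [(Nat.cast_nonneg l : (0 : ℝ) ≤ l)]
    have h0 : a + l + 1 ≠ 0 := by
      intro h
      have := congrArg Complex.re h
      simp at this
      linarith [(Nat.cast_nonneg l : (0 : ℝ) ≤ l)]
    have hcx : Continuous fun x : ℝ => (x : ℂ) ^ a :=
      Complex.continuous_ofReal_cpow_const (y := a) (by linarith)
    rw [intervalIntegral.integral_comp_sub_left
      (fun x : ℝ => (x : ℂ) ^ l * (1 - (x : ℂ) ^ a)) 1, sub_self, sub_zero]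
    simp_rw [mul_sub, mul_one]
    rw [intervalIntegral.integral_sub (Continuous.intervalIntegrable (by fun_prop) _ _)
      (Continuous.intervalIntegrable (by fun_prop) _ _)]
    congr 1
    · have : ∫ t : ℝ in 0..1, (t : ℂ) ^ l = ((∫ t : ℝ in 0..1, t ^ l : ℝ) : ℂ) := by
        rw [← intervalIntegral.integral_ofReal]
        congr 1; ext t; push_cast; rfl
      rw [this, integral_pow]
      simp
    · have : ∫ x : ℝ in 0..1, (x : ℂ) ^ l * (x : ℂ) ^ a = ∫ x : ℝ in 0..1, (x : ℂ) ^ (a + l) := by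
        refine intervalIntegral.integral_congr_ae ?_
        refine Eventually.of_forall fun x hx => ?_
        rw [Set.uIoc_of_le zero_le_one] at hx
        have hx0 : (x : ℂ) ≠ 0 := by exact_mod_cast hx.1.ne'
        rw [Complex.cpow_add _ _ hx0, Complex.cpow_natCast, mul_comm]
      rw [this, integral_cpow (Or.inl hre)]
      simp [Complex.zero_cpow h0]
  have hci : ∀ l ∈ Finset.range L, IntervalIntegrable
      (fun t : ℝ => ((1 - t : ℝ) : ℂ) ^ l * (1 - ((1 - t : ℝ) : ℂ) ^ a))
      MeasureTheory.volume 0 1 := fun l _ => Continuous.intervalIntegrable (by fun_prop) _ _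
  simp_rw [← hterm]
  rw [harm, ← intervalIntegral.integral_finsetSum hci, ← intervalIntegral.integral_sub
    (intervalIntegrable_harm ha)
    (Continuous.intervalIntegrable (by fun_prop) _ _)]
  have hbound : ∫ t : ℝ in 0..1, ‖a‖ * (1 - t) ^ L = ‖a‖ / (L + 1) := by
    rw [intervalIntegral.integral_const_mul, intervalIntegral.integral_comp_sub_left
      (fun x : ℝ => x ^ L) 1, sub_self, sub_zero, integral_pow]
    simp
    ring
  rw [← hbound]
  refine intervalIntegral.norm_integral_le_of_norm_le zero_le_one ?_
    (Continuous.intervalIntegrable (by fun_prop) _ _)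
  refine Eventually.of_forall fun t ht => ?_
  have ht0 : (t : ℂ) ≠ 0 := by exact_mod_cast ht.1.ne'
  have hg : ∑ l ∈ Finset.range L, ((1 - t : ℝ) : ℂ) ^ l = (1 - ((1 - t : ℝ) : ℂ) ^ L) / t := by
    rw [eq_div_iff ht0]
    have := mul_neg_geom_sum ((1 - t : ℝ) : ℂ) L
    rw [← this]
    push_cast
    ring
  rw [← Finset.sum_mul, hg]
  have e : (1 - ((1 - t : ℝ) : ℂ) ^ a) / t
      - (1 - ((1 - t : ℝ) : ℂ) ^ L) / t * (1 - ((1 - t : ℝ) : ℂ) ^ a) =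
      (1 - ((1 - t : ℝ) : ℂ) ^ a) / t * ((1 - t : ℝ) : ℂ) ^ L := by
    ring
  rw [e, norm_mul, norm_pow, Complex.norm_real, Real.norm_of_nonneg (by linarith [ht.2])]
  refine mul_le_mul_of_nonneg_right ?_ (pow_nonneg (by linarith [ht.2]) _)
  have := norm_one_sub_cpow_div_le ha (x := 1 - t) (by linarith [ht.1]) (by linarith [ht.2])
  simpa using this

theorem tendsto_sum_harm {a : ℂ} (ha : 1 < a.re) :
    Tendsto (fun L => ∑ l ∈ Finset.range L, (1 / ((l : ℂ) + 1) - 1 / (a + l + 1))) atTop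
      (𝓝 (harm a)) := by
  rw [tendsto_iff_norm_sub_tendsto_zero]
  refine squeeze_zero (fun _ => norm_nonneg _) (fun L => ?_)
    ((tendsto_one_div_add_atTop_nhds_zero_nat (𝕜 := ℝ)).const_mul ‖a‖ |>.trans (by simp))
  rw [norm_sub_rev, mul_one_div]
  exact norm_harm_sub_le ha L

/-- Here `harm a = γ + ψ(a+1)`, and the finite sum of reciprocals undoes the shift by `M`. Partial
sums of length `L + M` and `L` are compared; the surplus tail of the harmonic series tends to `0`.
-/
theorem digammaSeries_eq {z : ℂ} (hz : ‖z‖ ≤ 1 / 2) {M : ℕ} (hM : 2 ≤ M) :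
    Real.eulerMascheroniConstant + (∑ j ∈ Finset.range M, 1 / (z + j + 1) - harm (z + M)) =
      digammaSeries z := by
  have hzre := (Complex.abs_re_le_norm z).trans hz
  rw [abs_le] at hzre
  have hM' : (2 : ℝ) ≤ M := by exact_mod_cast hM
  have h1 := tendsto_sum_harm (a := z + M) (by
    rw [Complex.add_re, Complex.natCast_re]; linarith [hzre.1])
  have h2 := (tendsto_add_atTop_iff_nat M).2 (hasSum_digammaSeries hz).tendsto_sum_nat
  have h3 : Tendsto (fun L : ℕ => ∑ j ∈ Finset.range M, 1 / ((L : ℂ) + j + 1)) atTop (𝓝 0) := by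
    have : Tendsto (fun L : ℕ => ∑ j ∈ Finset.range M, 1 / ((L : ℂ) + j + 1)) atTop
        (𝓝 (∑ j ∈ Finset.range M, (0 : ℂ))) := by
      refine tendsto_finsetSum _ fun j _ => ?_
      have := (tendsto_add_atTop_iff_nat j).2 (tendsto_one_div_add_atTop_nhds_zero_nat (𝕜 := ℂ))
      simpa using this
    simpa using this
  have h4 : Tendsto (fun L : ℕ => ∑ j ∈ Finset.range M, 1 / (z + j + 1)
      - ∑ l ∈ Finset.range L, (1 / ((l : ℂ) + 1) - 1 / (z + M + l + 1))) atTop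
      (𝓝 (digammaSeries z - Real.eulerMascheroniConstant + 0)) := by
    refine (h2.add h3).congr fun L => ?_
    have s1 : ∑ l ∈ Finset.range (L + M), 1 / (z + l + 1) = ∑ j ∈ Finset.range M, 1 / (z + j + 1)
        + ∑ l ∈ Finset.range L, 1 / (z + M + l + 1) := by
      rw [add_comm L M, Finset.sum_range_add]
      push_cast
      simp only [add_assoc]
    have s2 : ∑ l ∈ Finset.range (L + M), 1 / ((l : ℂ) + 1) =
        ∑ l ∈ Finset.range L, 1 / ((l : ℂ) + 1) + ∑ j ∈ Finset.range M, 1 / ((L : ℂ) + j + 1) := by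
      rw [Finset.sum_range_add]
      push_cast
      rfl
    rw [Finset.sum_sub_distrib, Finset.sum_sub_distrib, s1, s2]
    ring
  have := tendsto_nhds_unique (h1.const_sub _) h4
  rw [this]
  ring

/-! ### The holomorphic main part and Cauchy's estimate. -/

/-- The expansion of `convSum z n` to order `N`. -/
noncomputable def mainPart (N n : ℕ) (z : ℂ) : ℂ :=
  ∑ j ∈ Finset.range (N + 3), ((n : ℂ) ^ (j + 1))⁻¹ * riemannZeta (-j - z)
    + (Real.log n * (n : ℂ) ^ z + digammaSeries z * (n : ℂ) ^ z)
    - ∑ i ∈ Finset.range (N + 1), (bernoulli (i + 1) : ℂ) / ((i + 1).factorial : ℂ) / (i + 1) *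
        ((n : ℂ) ^ (i + 1))⁻¹ * (ff z (i + 1) * (n : ℂ) ^ z)

theorem norm_convSum_sub_mainPart_le (N : ℕ) : ∃ K : ℝ, 0 ≤ K ∧ ∀ (z : ℂ) (n : ℕ),
    1 ≤ n → ‖z‖ ≤ 1 / 2 → ‖convSum z n - mainPart N n z‖ ≤ K * ((n : ℝ) ^ N)⁻¹ := by
  obtain ⟨K, hK, h⟩ := norm_convSum_sub_le_harm N
  refine ⟨K, hK, fun z n hn hz => ?_⟩
  refine le_of_eq_of_le ?_ (h z n hn hz)
  congr 2
  rw [mainPart, ← digammaSeries_eq hz (M := N + 3) (by omega)]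
  have e1 : ∑ j ∈ Finset.range (N + 3), ((n : ℂ) ^ (j + 1))⁻¹ * riemannZeta (-j - z) =
      ∑ j ∈ Finset.range (N + 3), riemannZeta (-(z + j)) * ((n : ℂ) ^ (j + 1))⁻¹ :=
    Finset.sum_congr rfl fun j _ => by rw [mul_comm, neg_add, neg_add_eq_sub]
  have e2 : ∑ i ∈ Finset.range (N + 1), (bernoulli (i + 1) : ℂ) / ((i + 1).factorial : ℂ) / (i + 1) *
        ((n : ℂ) ^ (i + 1))⁻¹ * (ff z (i + 1) * (n : ℂ) ^ z) =
      (n : ℂ) ^ z * ∑ i ∈ Finset.range (N + 1),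
        (bernoulli (i + 1) : ℂ) / ((i + 1).factorial : ℂ) *
            (ff z (i + 1) / (i + 1) * ((n : ℂ) ^ (i + 1))⁻¹) := by
    rw [Finset.mul_sum]
    exact Finset.sum_congr rfl fun i _ => by ring
  rw [e1, e2]
  ring

theorem differentiable_natCast_cpow {n : ℕ} (hn : 1 ≤ n) :
    Differentiable ℂ fun z : ℂ => (n : ℂ) ^ z :=
  differentiable_id.const_cpow (Or.inl (by exact_mod_cast (by omega : n ≠ 0)))

theorem contDiffAt_natCast_cpow {n : ℕ} (hn : 1 ≤ n) (p : ℕ) :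
    ContDiffAt ℂ p (fun z : ℂ => (n : ℂ) ^ z) 0 :=
  (differentiable_natCast_cpow hn).contDiff.contDiffAt

theorem iteratedDeriv_natCast_cpow {n : ℕ} (hn : 1 ≤ n) (p : ℕ) :
    iteratedDeriv p (fun z : ℂ => (n : ℂ) ^ z) 0 = (Real.log n : ℂ) ^ p := by
  have hn0 : (n : ℂ) ≠ 0 := by exact_mod_cast (by omega : n ≠ 0)
  have e : (fun z : ℂ => (n : ℂ) ^ z) = fun z => Complex.exp (Complex.log n * z) :=
    funext fun z => Complex.cpow_def_of_ne_zero hn0 z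
  rw [e, iteratedDeriv_cexp_const_mul]
  simp [Complex.natCast_log]

theorem differentiable_convSum (n : ℕ) : Differentiable ℂ fun z => convSum z n := by
  unfold convSum
  exact Differentiable.fun_sum fun k hk =>
    (differentiable_natCast_cpow (Finset.mem_Ico.1 hk).1).div_const _

theorem iteratedDeriv_convSum (p n : ℕ) :
    iteratedDeriv p (fun z => convSum z n) 0 = (logSum p n : ℂ) := by
  unfold convSum
  rw [iteratedDeriv_fun_sum fun k hk => by
    simpa only [div_eq_mul_inv] using
      (contDiffAt_natCast_cpow (Finset.mem_Ico.1 hk).1 p).mul contDiffAt_const]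
  rw [logSum, Complex.ofReal_sum]
  refine Finset.sum_congr rfl fun k hk => ?_
  rw [iteratedDeriv_div_const, iteratedDeriv_natCast_cpow (Finset.mem_Ico.1 hk).1]
  push_cast
  rfl

theorem differentiableOn_zeta_term (j : ℕ) :
    DifferentiableOn ℂ (fun z : ℂ => riemannZeta (-j - z)) (Metric.ball 0 1) := by
  intro z hz
  have hz' : ‖z‖ < 1 := by simpa using hz
  have hne : -(j : ℂ) - z ≠ 1 := by
    intro h
    have h1 : ((j + 1 : ℕ) : ℂ) = -z := by push_cast; linear_combination -h
    have h2 := congrArg norm h1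
    rw [Complex.norm_natCast, norm_neg] at h2
    push_cast at h2
    linarith [(Nat.cast_nonneg j : (0 : ℝ) ≤ j)]
  have h := (differentiableAt_riemannZeta hne).comp z
    ((differentiableAt_const (-(j : ℂ))).sub differentiableAt_id)
  exact h.differentiableWithinAt

theorem differentiableOn_digammaSeries : DifferentiableOn ℂ digammaSeries (Metric.ball 0 1) := by
  obtain ⟨B, hB⟩ := exists_digammaCoeff_bound
  exact differentiableOn_tsum_ball hB

theorem differentiableOn_mainPart (N : ℕ) {n : ℕ} (hn : 1 ≤ n) :
    DifferentiableOn ℂ (mainPart N n) (Metric.ball 0 1) := by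
  have hc := (differentiable_natCast_cpow hn).differentiableOn (s := Metric.ball (0 : ℂ) 1)
  unfold mainPart
  refine DifferentiableOn.sub (DifferentiableOn.add ?_
    ((hc.const_mul _).add (differentiableOn_digammaSeries.mul hc))) ?_
  · exact DifferentiableOn.fun_sum fun j _ => (differentiableOn_zeta_term j).const_mul _
  · exact DifferentiableOn.fun_sum fun i _ =>
      ((differentiable_ff (i + 1)).differentiableOn.mul hc).const_mul _

theorem contDiffAt_of_differentiableOn_ball {f : ℂ → ℂ}
    (hf : DifferentiableOn ℂ f (Metric.ball 0 1)) (p : ℕ) : ContDiffAt ℂ p f 0 :=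
  (hf.analyticAt (Metric.ball_mem_nhds 0 one_pos)).contDiffAt

/-- Cauchy's estimate on `‖z‖ = 1/2`: differentiating the error `p` times costs only the factor `p!
2^p`. -/
theorem norm_logSum_sub_iteratedDeriv_le (p N : ℕ) : ∃ K : ℝ, 0 ≤ K ∧ ∀ n : ℕ, 1 ≤ n →
    ‖(logSum p n : ℂ) - iteratedDeriv p (mainPart N n) 0‖ ≤ K * ((n : ℝ) ^ N)⁻¹ := by
  obtain ⟨K, hK, h⟩ := norm_convSum_sub_mainPart_le N
  refine ⟨p.factorial * K / (1 / 2) ^ p, by positivity, fun n hn => ?_⟩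
  have hd := (differentiable_convSum n).differentiableOn.sub (differentiableOn_mainPart N hn)
  have key := Complex.norm_iteratedDeriv_le_of_forall_mem_sphere_norm_le (c := 0) (R := 1 / 2)
    (C := K * ((n : ℝ) ^ N)⁻¹) p (by norm_num)
    (hd.diffContOnCl_ball (Metric.closedBall_subset_ball (by norm_num)))
    (fun z hz => h z n hn (by simpa using (mem_sphere_zero_iff_norm.1 hz).le))
  rw [iteratedDeriv_sub (differentiable_convSum n).contDiff.contDiffAt
    (contDiffAt_of_differentiableOn_ball (differentiableOn_mainPart N hn) p),
    iteratedDeriv_convSum] at key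
  exact key.trans (le_of_eq (by ring))

/-! ### Derivatives of the main part at the origin. -/

theorem iteratedDeriv_mul_cpow {F : ℂ → ℂ} {p : ℕ} (hF : ContDiffAt ℂ p F 0) {n : ℕ}
    (hn : 1 ≤ n) : iteratedDeriv p (fun z => F z * (n : ℂ) ^ z) 0 =
      F 0 * (Real.log n : ℂ) ^ p + ∑ r ∈ Finset.Icc 1 p,
        (p.choose r : ℂ) * iteratedDeriv r F 0 * (Real.log n : ℂ) ^ (p - r) := by
  rw [iteratedDeriv_fun_mul hF (contDiffAt_natCast_cpow hn p), Finset.range_eq_Ico,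
    Finset.sum_eq_sum_Ico_succ_bot (by omega)]
  simp_rw [iteratedDeriv_natCast_cpow hn]
  simp only [Nat.choose_zero_right, Nat.cast_one, one_mul, iteratedDeriv_zero, Nat.sub_zero]
  rfl

theorem choose_mul_factorial {p r : ℕ} (hr : r ≤ p) :
    (p.choose r : ℂ) * r.factorial = p.factorial / (p - r).factorial := by
  rw [eq_div_iff (by exact_mod_cast (p - r).factorial_ne_zero)]
  exact_mod_cast Nat.choose_mul_factorial_mul_factorial hr

theorem iteratedDeriv_digammaSeries_mul (p : ℕ) {n : ℕ} (hn : 1 ≤ n) :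
    iteratedDeriv p (fun z => digammaSeries z * (n : ℂ) ^ z) 0 =
      Real.eulerMascheroniConstant * (Real.log n : ℂ) ^ p +
        ∑ r ∈ Finset.Icc 1 p, c p r * (Real.log n : ℂ) ^ (p - r) := by
  obtain ⟨B, hB⟩ := exists_digammaCoeff_bound
  have hr : ∀ r, iteratedDeriv r digammaSeries 0 = r.factorial * digammaCoeff r :=
    iteratedDeriv_tsum_zero hB
  rw [iteratedDeriv_mul_cpow (contDiffAt_of_differentiableOn_ball differentiableOn_digammaSeries p)
    hn]
  congr 1
  · have := hr 0
    rw [iteratedDeriv_zero] at this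
    rw [this]
    simp [digammaCoeff]
  · refine Finset.sum_congr rfl fun r hr' => ?_
    obtain ⟨h1, h2⟩ := Finset.mem_Icc.1 hr'
    rw [hr, ← mul_assoc, choose_mul_factorial h2, digammaCoeff, if_neg (by omega), c]
    ring

/-- The `S r 1 t` are the elementary symmetric functions of `1, 1/2, …, 1/t`; this is how they enter
the Taylor coefficients of falling factorials. -/
theorem prod_one_sub_div (t : ℕ) (z : ℂ) :
    ∏ l ∈ Finset.Icc 1 t, (1 - z / l) =
      ∑ r ∈ Finset.range (t + 1), (-1) ^ r * (S r 1 t : ℂ) * z ^ r := by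
  simp_rw [sub_eq_add_neg]
  rw [Finset.prod_one_add, Finset.sum_powerset, Nat.card_Icc, Nat.add_sub_cancel]
  refine Finset.sum_congr rfl fun r _ => ?_
  rw [S, Rat.cast_sum, mul_right_comm, ← mul_pow, neg_one_mul, Finset.mul_sum]
  refine Finset.sum_congr rfl fun A hA => ?_
  rw [Rat.cast_prod, ← (Finset.mem_powersetCard.1 hA).2, ← Finset.prod_const,
    ← Finset.prod_mul_distrib]
  exact Finset.prod_congr rfl fun l _ => by push_cast; ring

theorem ff_succ_eq_sum (z : ℂ) (t : ℕ) :
    ff z (t + 1) = ∑ r ∈ Finset.range (t + 1),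
      ((-1) ^ t * t.factorial * ((-1) ^ r * (S r 1 t : ℂ))) * z ^ (r + 1) := by
  have h : ff z (t + 1) = (-1) ^ t * t.factorial * z * ∏ l ∈ Finset.Icc 1 t, (1 - z / l) := by
    induction t with
    | zero => simp [ff]
    | succ t ih =>
      rw [ff_succ, ih, Finset.prod_Icc_succ_top (by omega), Nat.factorial_succ]
      have : ((t : ℂ) + 1) ≠ 0 := by exact_mod_cast t.succ_ne_zero
      push_cast
      field_simp
      ring
  rw [h, prod_one_sub_div, Finset.mul_sum]
  exact Finset.sum_congr rfl fun r _ => by ring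

theorem S_eq_zero {r t : ℕ} (h : t < r) : S r 1 t = 0 := by
  rw [S, Finset.powersetCard_eq_empty.2 (by simpa using h), Finset.sum_empty]

theorem iteratedDeriv_ff (t q : ℕ) :
    iteratedDeriv (q + 1) (fun z => ff z (t + 1)) 0 =
      (q + 1).factorial * ((-1) ^ t * t.factorial * ((-1) ^ q * (S q 1 t : ℂ))) := by
  simp_rw [ff_succ_eq_sum]
  rw [iteratedDeriv_fun_sum fun r _ => by fun_prop]
  simp_rw [iteratedDeriv_const_mul_field]
  simp only [iteratedDeriv_fun_pow_zero]
  by_cases hq : q < t + 1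
  · rw [Finset.sum_eq_single_of_mem q (Finset.mem_range.2 hq)]
    · rw [if_pos rfl]; ring
    · intro r _ hr
      rw [if_neg (by omega), Nat.cast_zero, mul_zero]
  · rw [S_eq_zero (by omega)]
    simp only [Rat.cast_zero, mul_zero]
    refine Finset.sum_eq_zero fun r hr => ?_
    have := Finset.mem_range.1 hr
    rw [if_neg (by omega), Nat.cast_zero, mul_zero]

/-- The logarithmic part of the coefficient of `1 / n^k`. -/
noncomputable def logCoeff (p k n : ℕ) : ℂ :=
  -((-1) ^ k * (bernoulli k : ℂ) / (k : ℂ) ^ 2 *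
      ∑ r ∈ Finset.Icc 1 p, (d p r k : ℂ) * (Real.log n : ℂ) ^ (p - r))

/-- A falling factorial of positive length vanishes at `0`, so the Leibniz term `r = 0` drops out
and only powers of `log n` up to `p - 1` remain. -/
theorem iteratedDeriv_ff_mul (p i : ℕ) {n : ℕ} (hn : 1 ≤ n) :
    (bernoulli (i + 1) : ℂ) / ((i + 1).factorial : ℂ) / (i + 1) *
      iteratedDeriv p (fun z => ff z (i + 1) * (n : ℂ) ^ z) 0 = -logCoeff p (i + 1) n := by
  have hi : ((i : ℂ) + 1) ≠ 0 := by exact_mod_cast i.succ_ne_zero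
  have hif : (i.factorial : ℂ) ≠ 0 := by exact_mod_cast i.factorial_ne_zero
  rw [iteratedDeriv_mul_cpow (differentiable_ff (i + 1)).contDiff.contDiffAt hn, logCoeff, neg_neg,
    ff_succ', zero_mul, zero_mul, zero_add, Finset.mul_sum, Finset.mul_sum]
  refine Finset.sum_congr rfl fun r hr => ?_
  obtain ⟨h1, h2⟩ := Finset.mem_Icc.1 hr
  obtain ⟨q, rfl⟩ : ∃ q, r = q + 1 := ⟨r - 1, by omega⟩
  rw [iteratedDeriv_ff, ← mul_assoc (p.choose (q + 1) : ℂ), choose_mul_factorial h2, d,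
    Nat.add_sub_cancel, Nat.add_sub_cancel, Nat.factorial_succ i]
  push_cast
  field_simp
  ring

theorem coeff_eq (p j n : ℕ) :
    coeff p (j + 1) n = logCoeff p (j + 1) n + (-1) ^ p * iteratedDeriv p riemannZeta (-j) := by
  rw [coeff, logCoeff, show (1 : ℂ) - ((j + 1 : ℕ) : ℂ) = -j by push_cast; ring]
  ring

theorem iteratedDeriv_mainPart (p N : ℕ) {n : ℕ} (hn : 1 ≤ n) :
    iteratedDeriv p (mainPart N n) 0 =
      ∑ j ∈ Finset.range (N + 3), (-1) ^ p * iteratedDeriv p riemannZeta (-j) *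
        ((n : ℂ) ^ (j + 1))⁻¹
      + ((Real.log n : ℂ) ^ (p + 1) + Real.eulerMascheroniConstant * (Real.log n : ℂ) ^ p
        + ∑ r ∈ Finset.Icc 1 p, c p r * (Real.log n : ℂ) ^ (p - r))
      + ∑ i ∈ Finset.range (N + 1), logCoeff p (i + 1) n * ((n : ℂ) ^ (i + 1))⁻¹ := by
  have hc := contDiffAt_natCast_cpow hn p
  have hz : ∀ j ∈ Finset.range (N + 3), ContDiffAt ℂ p
      (fun z : ℂ => ((n : ℂ) ^ (j + 1))⁻¹ * riemannZeta (-j - z)) 0 := fun j _ =>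
    contDiffAt_const.mul (contDiffAt_of_differentiableOn_ball (differentiableOn_zeta_term j) p)
  have hg : ContDiffAt ℂ p (fun z : ℂ => digammaSeries z * (n : ℂ) ^ z) 0 :=
    (contDiffAt_of_differentiableOn_ball differentiableOn_digammaSeries p).mul hc
  have hl : ContDiffAt ℂ p (fun z : ℂ => Real.log n * (n : ℂ) ^ z) 0 := contDiffAt_const.mul hc
  have hf : ∀ i ∈ Finset.range (N + 1), ContDiffAt ℂ p (fun z : ℂ =>
      (bernoulli (i + 1) : ℂ) / ((i + 1).factorial : ℂ) / (i + 1) *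
        ((n : ℂ) ^ (i + 1))⁻¹ * (ff z (i + 1) * (n : ℂ) ^ z)) 0 := fun i _ =>
    contDiffAt_const.mul ((differentiable_ff (i + 1)).contDiff.contDiffAt.mul hc)
  unfold mainPart
  rw [iteratedDeriv_fun_sub ((ContDiffAt.sum hz).add (hl.add hg)) (ContDiffAt.sum hf),
    iteratedDeriv_fun_add (ContDiffAt.sum hz) (hl.add hg), iteratedDeriv_fun_add hl hg,
    iteratedDeriv_fun_sum hz, iteratedDeriv_fun_sum hf, iteratedDeriv_digammaSeries_mul p hn]
  simp_rw [iteratedDeriv_const_mul_field, iteratedDeriv_natCast_cpow hn]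
  have e1 : ∀ j : ℕ, iteratedDeriv p (fun z : ℂ => riemannZeta (-j - z)) 0 =
      (-1) ^ p * iteratedDeriv p riemannZeta (-j) := by
    intro j
    rw [iteratedDeriv_comp_const_sub]
    simp
  have e2 : ∑ i ∈ Finset.range (N + 1), (bernoulli (i + 1) : ℂ) / ((i + 1).factorial : ℂ) / (i + 1) *
        ((n : ℂ) ^ (i + 1))⁻¹ * iteratedDeriv p (fun z => ff z (i + 1) * (n : ℂ) ^ z) 0 =
      -∑ i ∈ Finset.range (N + 1), logCoeff p (i + 1) n * ((n : ℂ) ^ (i + 1))⁻¹ := by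
    rw [← Finset.sum_neg_distrib]
    refine Finset.sum_congr rfl fun i _ => ?_
    rw [mul_right_comm, iteratedDeriv_ff_mul p i hn]
    ring
  simp_rw [e1]
  rw [e2, Finset.sum_congr rfl fun j _ => mul_comm ((n : ℂ) ^ (j + 1))⁻¹ _]
  ring

/-! ### Collecting the error terms and the limit. -/

theorem isBigO_log_pow_mul {p m q k : ℕ} (hq : q ≤ p - 1) (hk : m + 1 ≤ k) (a : ℂ) :
    (fun n : ℕ => a * (Real.log n : ℂ) ^ q * ((n : ℂ) ^ k)⁻¹) =O[atTop]
      fun n : ℕ => Real.log n ^ (p - 1) / (n : ℝ) ^ (m + 1) := by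
  refine IsBigO.of_bound ‖a‖ ?_
  -- From `n = 3 > e` on, `log n ≥ 1`, so its powers increase with the exponent.
  filter_upwards [eventually_ge_atTop 3] with n hn
  have hn3 : (3 : ℝ) ≤ n := by exact_mod_cast hn
  have hlog : 1 ≤ Real.log n := by
    rw [Real.le_log_iff_exp_le (by linarith)]
    linarith [Real.exp_one_lt_d9]
  rw [norm_mul, norm_mul, norm_pow, norm_inv, norm_pow, Complex.norm_natCast, Complex.norm_real,
    norm_div, norm_pow, norm_pow, Real.norm_of_nonneg (by linarith : 0 ≤ Real.log n),
    Real.norm_of_nonneg (by linarith : (0 : ℝ) ≤ n), mul_assoc, div_eq_mul_inv]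
  gcongr
  · linarith

theorem isBigO_logCoeff {p m k : ℕ} (hk : m + 1 ≤ k) :
    (fun n : ℕ => logCoeff p k n * ((n : ℂ) ^ k)⁻¹) =O[atTop]
      fun n : ℕ => Real.log n ^ (p - 1) / (n : ℝ) ^ (m + 1) := by
  have e : (fun n : ℕ => logCoeff p k n * ((n : ℂ) ^ k)⁻¹) = fun n : ℕ =>
      ∑ r ∈ Finset.Icc 1 p, (-((-1) ^ k * (bernoulli k : ℂ) / (k : ℂ) ^ 2) * (d p r k : ℂ)) *
        (Real.log n : ℂ) ^ (p - r) * ((n : ℂ) ^ k)⁻¹ := by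
    ext n
    rw [logCoeff, Finset.mul_sum, ← Finset.sum_neg_distrib, Finset.sum_mul]
    exact Finset.sum_congr rfl fun r _ => by ring
  rw [e]
  refine IsBigO.fun_sum fun r hr => isBigO_log_pow_mul ?_ hk _
  have := Finset.mem_Icc.1 hr
  omega

theorem isBigO_logSum_sub (p m : ℕ) :
    (fun n : ℕ => (logSum p n : ℂ) -
          ((Real.log n : ℂ) ^ (p + 1)
            + (Real.eulerMascheroniConstant : ℂ) * (Real.log n : ℂ) ^ p
            + ∑ r ∈ Finset.Icc 1 p, c p r * (Real.log n : ℂ) ^ (p - r)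
            + ∑ k ∈ Finset.Icc 1 m, coeff p k n * (1 / (n : ℂ) ^ k)))
        =O[atTop] (fun n : ℕ => Real.log n ^ (p - 1) / (n : ℝ) ^ (m + 1)) := by
  -- Order `m + 1` makes the remainder `O(n^(-(m+1)))`; the main part then carries terms beyond
  -- `1/n^m`, all absorbed by the error.
  obtain ⟨K, hK, h⟩ := norm_logSum_sub_iteratedDeriv_le p (m + 1)
  have h1 : (fun n : ℕ => (logSum p n : ℂ) - iteratedDeriv p (mainPart (m + 1) n) 0)
      =O[atTop] (fun n : ℕ => Real.log n ^ (p - 1) / (n : ℝ) ^ (m + 1)) := by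
    refine IsBigO.trans (IsBigO.of_bound K ?_)
      (isBigO_log_pow_mul (p := p) (q := 0) (k := m + 1) (Nat.zero_le _) le_rfl 1)
    filter_upwards [eventually_ge_atTop 1] with n hn
    simpa using h n hn
  have h2 : (fun n : ℕ => ∑ j ∈ Finset.Ico m (m + 1 + 3), (-1) ^ p *
      iteratedDeriv p riemannZeta (-j) * ((n : ℂ) ^ (j + 1))⁻¹)
      =O[atTop] (fun n : ℕ => Real.log n ^ (p - 1) / (n : ℝ) ^ (m + 1)) := by
    refine IsBigO.fun_sum fun j hj => ?_
    have := Finset.mem_Ico.1 hj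
    simpa using isBigO_log_pow_mul (p := p) (m := m) (q := 0) (k := j + 1) (Nat.zero_le _)
      (by omega) ((-1) ^ p * iteratedDeriv p riemannZeta (-j))
  have h3 : (fun n : ℕ => ∑ i ∈ Finset.Ico m (m + 1 + 1), logCoeff p (i + 1) n *
      ((n : ℂ) ^ (i + 1))⁻¹)
      =O[atTop] (fun n : ℕ => Real.log n ^ (p - 1) / (n : ℝ) ^ (m + 1)) := by
    refine IsBigO.fun_sum fun j hj => isBigO_logCoeff ?_
    have := Finset.mem_Ico.1 hj
    omega
  refine ((h1.add h2).add h3).congr' ?_ EventuallyEq.rfl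
  filter_upwards [eventually_ge_atTop 1] with n hn
  have e : ∑ k ∈ Finset.Icc 1 m, coeff p k n * (1 / (n : ℂ) ^ k) =
      ∑ j ∈ Finset.range m, logCoeff p (j + 1) n * ((n : ℂ) ^ (j + 1))⁻¹ +
      ∑ j ∈ Finset.range m, (-1) ^ p * iteratedDeriv p riemannZeta (-j) *
        ((n : ℂ) ^ (j + 1))⁻¹ := by
    rw [← Finset.sum_add_distrib, Finset.range_eq_Ico]
    have := Finset.sum_Ico_add' (fun k => coeff p k n * (1 / (n : ℂ) ^ k)) 0 m 1
    rw [zero_add] at this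
    rw [show Finset.Icc 1 m = Finset.Ico 1 (m + 1) from rfl, ← this]
    refine Finset.sum_congr rfl fun j _ => ?_
    rw [coeff_eq, one_div]
    ring
  rw [iteratedDeriv_mainPart p (m + 1) hn, e,
    ← Finset.sum_range_add_sum_Ico _ (by omega : m ≤ m + 1 + 3),
    ← Finset.sum_range_add_sum_Ico _ (by omega : m ≤ m + 1 + 1)]
  ring

theorem tendsto_log_pow_div (q : ℕ) :
    Tendsto (fun n : ℕ => Real.log n ^ q / (n : ℝ) ^ (0 + 1)) atTop (𝓝 0) := by
  have h := (Real.isLittleO_pow_log_id_atTop (n := q)).tendsto_div_nhds_zero.comp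
    tendsto_natCast_atTop_atTop
  simpa [Function.comp_def] using h

end LogSum

theorem mainTheorem5 (p : ℕ) (hp : 1 ≤ p) :
    (∀ m : ℕ,
      (fun n : ℕ => (LogSum.logSum p n : ℂ) -
          ((Real.log n : ℂ) ^ (p + 1)
            + (Real.eulerMascheroniConstant : ℂ) * (Real.log n : ℂ) ^ p
            + ∑ r ∈ Finset.Icc 1 p, LogSum.c p r * (Real.log n : ℂ) ^ (p - r)
            + ∑ k ∈ Finset.Icc 1 m, LogSum.coeff p k n * (1 / (n : ℂ) ^ k)))
        =O[atTop] (fun n : ℕ => Real.log n ^ (p - 1) / (n : ℝ) ^ (m + 1))) ∧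
    Tendsto
      (fun n : ℕ => (LogSum.logSum p n : ℂ) -
          ((Real.log n : ℂ) ^ (p + 1)
            + (Real.eulerMascheroniConstant : ℂ) * (Real.log n : ℂ) ^ p
            + ∑ r ∈ Finset.Ico 1 p, LogSum.c p r * (Real.log n : ℂ) ^ (p - r)))
      atTop (𝓝 ((-1) ^ p * (p.factorial : ℂ) * riemannZeta ((p : ℂ) + 1))) := by
  refine ⟨LogSum.isBigO_logSum_sub p, ?_⟩
  -- Take `m = 0`. The summand `r = p` carries no logarithm, so moving `c p p` to the other side
  -- gives the limit.
  have h := (LogSum.isBigO_logSum_sub p 0).trans_tendsto (LogSum.tendsto_log_pow_div (p - 1))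
  have h' := h.add_const (LogSum.c p p)
  have hc : 0 + LogSum.c p p = (-1) ^ p * (p.factorial : ℂ) * riemannZeta ((p : ℂ) + 1) := by
    simp [LogSum.c]
  rw [hc] at h'
  refine h'.congr fun n => ?_
  rw [← Finset.sum_Ico_add_eq_sum_Icc hp, Finset.Icc_eq_empty (by omega), Finset.sum_empty,
    Nat.sub_self, pow_zero]
  ring
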